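/- Let $d$ be a natural number and let $\mathcal F$ be the Fourier transform on $\mathcal S'(\mathbb R^d)$. Fix nonnegative radial functions $\chi,\varphi\in C_c^\infty(\mathbb R^d)$ with $\chi$ supported in $\{|\xi|\le 1\}$, $\varphi$ supported in $\{1/2\le|\xi|\le 2\}$ and $\chi(\xi)+\sum_{q\ge 0}\varphi(2^{-q}\xi)=1$ for all $\xi\in\mathbb R^d$, and put $\dot\Delta_q u=\mathcal F^{-1}(\varphi(2^{-q}\cdot)\,\mathcal F u)$ for $q\in\mathbb Z$. For $s\in\mathbb R$ let $\dot H^s(\mathbb R^d)$ be the space of all homogeneous tempered distributions $u$ (that is, $u\in\mathcal S'(\mathbb R^d)$ with $\|\theta(\lambda D)u\|_{L^\infty}\to 0$ as $\lambda\to\infty$ for every $\theta\in C_c^\infty(\mathbb R^d)$, where $\theta(\lambda D)u=\mathcal F^{-1}(\theta(\lambda\,\cdot)\,\mathcal F u)$) such that $$\|u\|_{\dot H^s}=\Big(\sum_{q\in\mathbb Z}2^{2qs}\|\dot\Delta_q u\|_{L^2}^2\Big)^{1/2}<\infty .$$ The product $ab$ of two tempered distributions $a,b$ is the limit in $\mathcal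 S'(\mathbb R^d)$, as $\varepsilon\to0^+$, of the pointwise products $(\theta(\varepsilon D)a)\,(\theta(\varepsilon D)b)$ of smooth functions, whenever this limit exists and is the same for every $\theta\in C_c^\infty(\mathbb R^d)$ equal to $1$ near the origin; for Schwartz functions it is the ordinary pointwise product. **Theorem.** Let $s,t$ be real numbers with $|s|<d/2$, $|t|<d/2$ and $s+t>0$. There is a constant $C>0$ such that for every $a\in\dot H^s(\mathbb R^d)$ and every $b\in\dot H^t(\mathbb R^d)$ the product $ab$ exists, belongs to $\dot H^{s+t-d/2}(\mathbb R^d)$, and $$\|ab\|_{\dot H^{s+t-d/2}}\le C\,\|a\|_{\dot H^s}\,\|b\|_{\dot H^t}.$$ -/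

import Mathlib

open MeasureTheory Filter Topology
open scoped SchwartzMap ENNReal ContDiff FourierTransform

noncomputable section

namespace HomSobolev

/-- The Euclidean space `ℝ^d`. -/
abbrev Sp (d : ℕ) : Type := EuclideanSpace ℝ (Fin d)

/-- A Littlewood-Paley pair `(χ, φ)`: two nonnegative radial smooth functions on `ℝ^d`, `χ`
supported in the unit ball, `φ` supported in the ring `1/2 ≤ |ξ| ≤ 2`, with
`χ(ξ) + ∑_{q ≥ 0} φ(2^{-q} ξ) = 1` for every `ξ`. -/
structure DyadicPartition (d : ℕ) where
  χ : Sp d → ℝ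
  φ : Sp d → ℝ
  χ_smooth : ContDiff ℝ ∞ χ
  φ_smooth : ContDiff ℝ ∞ φ
  χ_nonneg : ∀ ξ, 0 ≤ χ ξ
  φ_nonneg : ∀ ξ, 0 ≤ φ ξ
  χ_radial : ∀ ξ η, ‖ξ‖ = ‖η‖ → χ ξ = χ η
  φ_radial : ∀ ξ η, ‖ξ‖ = ‖η‖ → φ ξ = φ η
  χ_support : ∀ ξ, χ ξ ≠ 0 → ‖ξ‖ ≤ 1
  φ_support : ∀ ξ, φ ξ ≠ 0 → 1 / 2 ≤ ‖ξ‖ ∧ ‖ξ‖ ≤ 2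
  sum_eq : ∀ ξ, HasSum (fun q : ℕ => φ ((2 : ℝ) ^ (-(q : ℤ)) • ξ)) (1 - χ ξ)

variable {d : ℕ}

/-- The homogeneous dyadic block `Δ_q u = 𝓕⁻¹ (φ(2^{-q} ·) 𝓕 u)`. Mathlib's Fourier transform has
the kernel `exp (-2 π i x ξ)`; the factor `2 π` turns the formula into the one for the
kernel `exp (-i x ξ)`. -/
def DyadicPartition.block (P : DyadicPartition d) (q : ℤ) (u : 𝓢'(Sp d, ℂ)) : 𝓢'(Sp d, ℂ) :=
  TemperedDistribution.fourierMultiplierCLM ℂ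
    (fun ξ : Sp d => (P.φ ((2 : ℝ) ^ (-q) • (2 * Real.pi) • ξ) : ℂ)) u

/-- The `L^p` norm of a tempered distribution: the norm of the `L^p` function that represents it,
and `∞` if there is none. -/
def distLpNorm (p : ℝ≥0∞) [Fact (1 ≤ p)] (u : 𝓢'(Sp d, ℂ)) : ℝ≥0∞ :=
  ⨅ (f : Lp ℂ p (volume : Measure (Sp d))) (_ : Lp.toTemperedDistribution f = u), ‖f‖ₑ

/-- Homogeneous tempered distributions (the space `𝓢'_h`): those `u` with
`‖θ(lD) u‖_{L^∞} → 0` as `l → ∞`, for every `θ ∈ C_c^∞(ℝ^d)`. -/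
def IsHomogeneous (u : 𝓢'(Sp d, ℂ)) : Prop :=
  ∀ θ : Sp d → ℂ, ContDiff ℝ ∞ θ → HasCompactSupport θ →
    Tendsto (fun l : ℝ => distLpNorm ⊤
      (TemperedDistribution.fourierMultiplierCLM ℂ (fun ξ : Sp d => θ (l • ξ)) u)) atTop (𝓝 0)

/-- The norm `‖u‖_{Ḣ^s} = (∑_{q ∈ ℤ} 2^{2qs} ‖Δ_q u‖_{L²}²)^{1/2}`, with values in `[0, ∞]`. -/
def DyadicPartition.sobolevNorm (P : DyadicPartition d) (s : ℝ) (u : 𝓢'(Sp d, ℂ)) : ℝ≥0∞ :=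
  (∑' q : ℤ, ENNReal.ofReal ((2 : ℝ) ^ (2 * (q : ℝ) * s)) * distLpNorm 2 (P.block q u) ^ 2)
    ^ (1 / 2 : ℝ)

/-- The homogeneous Sobolev space `Ḣ^s(ℝ^d)`. -/
def DyadicPartition.MemSobolev (P : DyadicPartition d) (s : ℝ) (u : 𝓢'(Sp d, ℂ)) : Prop :=
  IsHomogeneous u ∧ P.sobolevNorm s u < ⊤

/-- The tempered distribution `u` is the smooth function `f`, whose derivatives of all orders have
at most polynomial growth. -/
def IsFunction (u : 𝓢'(Sp d, ℂ)) (f : Sp d → ℂ) : Prop :=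
  ∃ hf : f.HasTemperateGrowth, hf.toTemperedDistribution = u

/-- `c` is the product of the tempered distributions `a` and `b`: for every smooth, compactly
supported frequency cut-off `θ` equal to `1` near the origin, the pointwise products of the smooth
functions `θ(εD) a` and `θ(εD) b` converge to `c` in `𝓢'` as `ε → 0+`. -/
def IsProduct (a b c : 𝓢'(Sp d, ℂ)) : Prop :=
  ∀ θ : Sp d → ℂ, ContDiff ℝ ∞ θ → HasCompactSupport θ → (∀ᶠ ξ in 𝓝 0, θ ξ = 1) →
    ∃ (A B : ℝ → Sp d → ℂ) (p : ℝ → 𝓢'(Sp d, ℂ)),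
      (∀ ε > 0,
        IsFunction (TemperedDistribution.fourierMultiplierCLM ℂ (fun ξ => θ (ε • ξ)) a) (A ε) ∧
        IsFunction (TemperedDistribution.fourierMultiplierCLM ℂ (fun ξ => θ (ε • ξ)) b) (B ε) ∧
        IsFunction (p ε) (fun x => A ε x * B ε x)) ∧
      Tendsto p (𝓝[>] 0) (𝓝 c)

theorem IsFunction.eq {u v : 𝓢'(Sp d, ℂ)} {f : Sp d → ℂ} (hu : IsFunction u f)
    (hv : IsFunction v f) : u = v := by
  obtain ⟨_, rfl⟩ := hu
  obtain ⟨_, rfl⟩ := hv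
  rfl

theorem exists_cutoff (d : ℕ) : ∃ θ : Sp d → ℂ, ContDiff ℝ ∞ θ ∧ HasCompactSupport θ ∧
    ∀ᶠ ξ in 𝓝 0, θ ξ = 1 := by
  let f : ContDiffBump (0 : Sp d) := ⟨1, 2, one_pos, one_lt_two⟩
  refine ⟨fun ξ => (f ξ : ℂ), Complex.ofRealCLM.contDiff.comp f.contDiff,
    f.hasCompactSupport.comp_left (g := Complex.ofReal) (by simp), ?_⟩
  filter_upwards [f.eventuallyEq_one] with ξ h
  simp [h]

theorem cutoff_scale {θ : Sp d → ℂ} (h1 : ContDiff ℝ ∞ θ) (h2 : HasCompactSupport θ) (ε : ℝ) :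
    (fun ξ : Sp d => θ (ε • ξ)).HasTemperateGrowth :=
  (h2.hasTemperateGrowth h1).comp (f := fun ξ : Sp d => ε • ξ) (by fun_prop)

/-- For a Schwartz function `f`, `θ(εD) f → f` pointwise and boundedly. -/
theorem cutoff_tendsto_schwartz {θ : Sp d → ℂ} (h1 : ContDiff ℝ ∞ θ) (h2 : HasCompactSupport θ)
    (h3 : ∀ᶠ ξ in 𝓝 0, θ ξ = 1) (f : 𝓢(Sp d, ℂ)) :
    (∀ x, Tendsto (fun ε : ℝ => SchwartzMap.fourierMultiplierCLM ℂ (fun ξ => θ (ε • ξ)) f x)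
      (𝓝[>] 0) (𝓝 (f x))) ∧
    ∃ M : ℝ, ∀ (ε : ℝ) (x : Sp d), ‖SchwartzMap.fourierMultiplierCLM ℂ (fun ξ => θ (ε • ξ)) f x‖ ≤ M := by
  obtain ⟨K, hK⟩ := h2.exists_bound_of_continuous h1.continuous
  have key : ∀ (ε : ℝ) (x : Sp d), SchwartzMap.fourierMultiplierCLM ℂ (fun ξ => θ (ε • ξ)) f x =
      ∫ v, 𝐞 (inner ℝ v x) • (θ (ε • v) * (𝓕 f) v) := by
    intro ε x
    rw [SchwartzMap.fourierMultiplierCLM_apply, SchwartzMap.fourierInv_coe,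
      Real.fourierInv_eq]
    simp [SchwartzMap.smulLeftCLM_apply_apply (cutoff_scale h1 h2 ε)]
  have hb : ∀ (ε : ℝ) (x v : Sp d), ‖𝐞 (inner ℝ v x) • (θ (ε • v) * (𝓕 f) v)‖ ≤ K * ‖(𝓕 f) v‖ := by
    intro ε x v
    rw [Circle.norm_smul, norm_mul]
    gcongr
    exact hK _
  have hint : Integrable (fun v => K * ‖(𝓕 f) v‖) := ((𝓕 f).integrable.norm).const_mul K
  constructor
  · intro x
    have hx : f x = ∫ v, 𝐞 (inner ℝ v x) • (𝓕 f) v := by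
      rw [← Real.fourierInv_eq, ← SchwartzMap.fourierInv_coe]
      simp
    simp_rw [key]
    rw [hx]
    refine tendsto_integral_filter_of_dominated_convergence _ ?_ (.of_forall fun ε => .of_forall (hb ε x)) hint ?_
    · refine .of_forall fun ε => Continuous.aestronglyMeasurable ?_
      have := h1.continuous
      have := (𝓕 f).continuous
      fun_prop
    · refine .of_forall fun v => ?_
      have h0 : Tendsto (fun ε : ℝ => ε • v) (𝓝[>] 0) (𝓝 0) := by
        have : Tendsto (fun ε : ℝ => ε • v) (𝓝 0) (𝓝 ((0:ℝ) • v)) := by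
          apply Continuous.tendsto; fun_prop
        rw [zero_smul] at this
        exact this.mono_left nhdsWithin_le_nhds
      refine tendsto_const_nhds.congr' ?_
      filter_upwards [h0.eventually h3] with ε h
      rw [h, one_mul]
  · refine ⟨∫ v, K * ‖(𝓕 f) v‖, fun ε x => ?_⟩
    rw [key]
    exact norm_integral_le_of_norm_le hint (.of_forall (hb ε x))

theorem isFunction_schwartz (f : 𝓢(Sp d, ℂ)) : IsFunction (f : 𝓢'(Sp d, ℂ)) f :=
  ⟨f.hasTemperateGrowth, by ext g; simp⟩

/-- On Schwartz functions the product is the pointwise product. -/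
theorem isProduct_schwartz (f g : 𝓢(Sp d, ℂ)) :
    IsProduct (f : 𝓢'(Sp d, ℂ)) (g : 𝓢'(Sp d, ℂ))
      ((SchwartzMap.smulLeftCLM ℂ f g : 𝓢(Sp d, ℂ)) : 𝓢'(Sp d, ℂ)) := by
  intro θ h1 h2 h3
  let A := fun ε : ℝ => SchwartzMap.fourierMultiplierCLM ℂ (fun ξ : Sp d => θ (ε • ξ)) f
  let B := fun ε : ℝ => SchwartzMap.fourierMultiplierCLM ℂ (fun ξ : Sp d => θ (ε • ξ)) g
  obtain ⟨hA, MA, hMA⟩ := cutoff_tendsto_schwartz h1 h2 h3 f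
  obtain ⟨hB, MB, hMB⟩ := cutoff_tendsto_schwartz h1 h2 h3 g
  refine ⟨fun ε => A ε, fun ε => B ε, fun ε =>
    ((SchwartzMap.smulLeftCLM ℂ (A ε) (B ε) : 𝓢(Sp d, ℂ)) : 𝓢'(Sp d, ℂ)), fun ε _ => ⟨?_, ?_, ?_⟩, ?_⟩
  · rw [TemperedDistribution.fourierMultiplierCLM_toTemperedDistributionCLM_eq (cutoff_scale h1 h2 ε)]
    exact isFunction_schwartz _
  · rw [TemperedDistribution.fourierMultiplierCLM_toTemperedDistributionCLM_eq (cutoff_scale h1 h2 ε)]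
    exact isFunction_schwartz _
  · convert isFunction_schwartz (SchwartzMap.smulLeftCLM ℂ (A ε) (B ε)) using 1
    ext x
    simp [SchwartzMap.smulLeftCLM_apply_apply (A ε).hasTemperateGrowth]
  · rw [PointwiseConvergenceCLM.tendsto_iff_forall_tendsto]
    intro v
    simp only [SchwartzMap.toTemperedDistributionCLM_apply_apply,
      SchwartzMap.smulLeftCLM_apply_apply (SchwartzMap.hasTemperateGrowth _)]
    refine tendsto_integral_filter_of_dominated_convergence (fun x => ‖v x‖ * (MA * MB)) ?_ ?_
      (v.integrable.norm.mul_const _) ?_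
    · refine .of_forall fun ε => Continuous.aestronglyMeasurable ?_
      exact v.continuous.smul ((A ε).continuous.smul (B ε).continuous)
    · refine .of_forall fun ε => .of_forall fun x => ?_
      rw [norm_smul, norm_smul]
      have := (norm_nonneg _).trans (hMA ε x)
      gcongr
      · exact hMA ε x
      · exact hMB ε x
    · exact .of_forall fun x => ((hA x).smul (hB x)).const_smul (v x)

/-- The product of two tempered distributions is unique if it exists. -/
theorem IsProduct.unique {a b c c' : 𝓢'(Sp d, ℂ)} (h : IsProduct a b c) (h' : IsProduct a b c') :
    c = c' := by
  obtain ⟨θ, h1, h2, h3⟩ := exists_cutoff d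
  obtain ⟨A, B, p, hp, hl⟩ := h θ h1 h2 h3
  obtain ⟨A', B', p', hp', hl'⟩ := h' θ h1 h2 h3
  have uni : ∀ (u : 𝓢'(Sp d, ℂ)) (f g : Sp d → ℂ), IsFunction u f → IsFunction u g → f = g := by
    rintro u f g ⟨hf, rfl⟩ ⟨hg, e⟩
    have hfc := (hf.1).continuous
    have hgc := (hg.1).continuous
    refine (Continuous.ae_eq_iff_eq volume hfc hgc).1 ?_
    refine ae_eq_of_integral_contDiff_smul_eq hfc.locallyIntegrable hgc.locallyIntegrable ?_
    intro v hv hv'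
    have hw : HasCompactSupport fun x => (v x : ℂ) :=
      hv'.comp_left (g := Complex.ofReal) (by simp)
    have := congrArg (fun T => T (hw.toSchwartzMap (Complex.ofRealCLM.contDiff.comp hv))) e
    simp only [Function.HasTemperateGrowth.toTemperedDistribution_apply] at this
    exact this.symm
  have : p =ᶠ[𝓝[>] 0] p' := by
    filter_upwards [self_mem_nhdsWithin] with ε hε
    obtain ⟨x1, x2, x3⟩ := hp ε hε
    obtain ⟨y1, y2, y3⟩ := hp' ε hε
    rw [uni _ _ _ x1 y1, uni _ _ _ x2 y2] at x3
    exact x3.eq y3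
  exact tendsto_nhds_unique hl (hl'.congr' this.symm)

/-- Littlewood-Paley pairs exist in every dimension. -/
theorem partition_nonempty (d : ℕ) : Nonempty (DyadicPartition d) := by
  let χ : Sp d → ℝ := fun ξ => Real.smoothTransition (3 - 4 * ‖ξ‖ ^ 2)
  have hχ : ContDiff ℝ ∞ χ := by
    have := contDiff_norm_sq ℝ (E := Sp d) (n := ∞)
    exact Real.smoothTransition.contDiff.comp (by fun_prop)
  have hn : ∀ ξ : Sp d, ‖(1 / 2 : ℝ) • ξ‖ = ‖ξ‖ / 2 := fun ξ => by
    rw [norm_smul]; norm_num; ring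
  have h1 : ∀ ξ : Sp d, ‖ξ‖ ≤ 1 / 2 → χ ξ = 1 := fun ξ h =>
    Real.smoothTransition.one_of_one_le (by nlinarith [norm_nonneg ξ])
  have h0 : ∀ ξ : Sp d, 1 ≤ ‖ξ‖ → χ ξ = 0 := fun ξ h =>
    Real.smoothTransition.zero_of_nonpos (by nlinarith [norm_nonneg ξ])
  have hφ : ∀ ξ, 0 ≤ χ ((1 / 2 : ℝ) • ξ) - χ ξ := fun ξ => by
    have : χ ξ ≤ χ ((1 / 2 : ℝ) • ξ) := by
      apply Real.smoothTransition.monotone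
      rw [hn]; nlinarith [norm_nonneg ξ]
    linarith
  refine ⟨⟨χ, fun ξ => χ ((1 / 2 : ℝ) • ξ) - χ ξ, hχ, ?_, fun ξ => Real.smoothTransition.nonneg _,
    hφ, ?_, ?_, ?_, ?_, ?_⟩⟩
  · exact (hχ.comp (by fun_prop)).sub hχ
  · intro ξ η h; simp only [χ, h]
  · intro ξ η h; simp only [χ, hn, h]
  · intro ξ h
    by_contra hh
    exact h (h0 ξ (not_le.1 hh).le)
  · intro ξ h
    constructor
    · by_contra! hh
      apply h
      rw [h1 ξ hh.le, h1 _ (by rw [hn]; linarith [norm_nonneg ξ])]; simp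
    · by_contra! hh
      apply h
      rw [h0 ξ (by linarith), h0 _ (by rw [hn]; linarith)]; simp
  · intro ξ
    rw [hasSum_iff_tendsto_nat_of_nonneg (fun q => hφ _)]
    have e : ∀ n : ℕ, ∑ q ∈ Finset.range n, (χ ((1 / 2 : ℝ) • (2 : ℝ) ^ (-(q : ℤ)) • ξ)
        - χ ((2 : ℝ) ^ (-(q : ℤ)) • ξ)) = χ (((1 / 2 : ℝ) ^ n) • ξ) - χ ξ := by
      intro n
      have e1 := Finset.sum_range_sub (fun q : ℕ => χ (((1 / 2 : ℝ) ^ q) • ξ)) n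
      simp only [pow_zero, one_smul] at e1
      rw [← e1]
      refine Finset.sum_congr rfl fun q _ => ?_
      rw [smul_smul, pow_succ']
      simp
    simp_rw [e]
    refine Tendsto.sub_const ?_ _
    have ht : Tendsto (fun n : ℕ => ((1 / 2 : ℝ) ^ n) • ξ) atTop (𝓝 0) := by
      have := (tendsto_pow_atTop_nhds_zero_of_lt_one (r := (1 / 2 : ℝ)) (by norm_num)
        (by norm_num)).smul_const ξ
      simpa using this
    have := (hχ.continuous.tendsto 0).comp ht
    rwa [h1 0 (by simp)] at this

end HomSobolev

end

/-! The product is studied on the Fourier side. When |s| < d/2, the Fourier transform of u ∈ Ḣ^s is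
a measurable function f, and the Ḣ^s norm is comparable to the norm of |ξ|^s f in L². The dyadic
blocks determine f away from the origin, with weighted norm controlled by Plancherel, and |s| < d/2
makes f a tempered function. What might remain of the Fourier transform of u is carried by the
origin, and homogeneity excludes it (`MemSobolev.exists_density`). Conversely, any density with
finite weighted norm gives a homogeneous distribution with the expected bound (`isHomogeneous`,
`sobolevNorm_sq_le`).

The product then becomes the convolution f * g, and the theorem reduces to a weighted L² estimate
for nonnegative functions (`exists_weightedNormSq_conv_le`). Split the integral of F(ξ) G(ζ - ξ)
according to whether |ξ| ≤ |ζ|/2, |ζ - ξ| ≤ |ζ|/2, or neither, and apply Cauchy-Schwarz in each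
region. The power integrals that appear converge at the origin precisely because s < d/2, t < d/2
and s + t > 0 respectively.

The same estimate, applied to |f| and |g|, makes the convolution absolutely convergent almost
everywhere and supplies a dominating function. The regularized products therefore converge to the
distribution with density f * g, whatever the cut-off (`isProduct_of_density`). -/

noncomputable section

namespace HomSobolev

variable {d : ℕ}

/-! ### Power weights and their integrals over balls -/

/-- The power weight `‖ξ‖ ^ p` with values in `[0, ∞]`. -/
def weight (p : ℝ) (ξ : Sp d) : ℝ≥0∞ := ENNReal.ofReal (‖ξ‖ ^ p)

@[fun_prop]
theorem measurable_weight (p : ℝ) : Measurable (weight p : Sp d → ℝ≥0∞) := by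
  unfold weight; fun_prop

theorem weight_mul {ξ : Sp d} (h : ξ ≠ 0) (p q : ℝ) :
    weight p ξ * weight q ξ = weight (p + q) ξ := by
  have := norm_pos_iff.2 h
  rw [weight, weight, weight, ← ENNReal.ofReal_mul (by positivity), Real.rpow_add this]

theorem weight_neg_mul {ξ : Sp d} (h : ξ ≠ 0) (p : ℝ) : weight (-p) ξ * weight p ξ = 1 := by
  rw [weight_mul h]; simp [weight]

theorem weight_sq {ξ : Sp d} (h : ξ ≠ 0) (p : ℝ) : weight p ξ ^ 2 = weight (2 * p) ξ := by
  rw [sq, weight_mul h, two_mul]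

/-- Powers of comparable positive numbers are comparable. -/
theorem rpow_le_rpow_of_comparable {a b K : ℝ} (p : ℝ) (ha : 0 < a) (hb : 0 < b) (hK : 1 ≤ K)
    (hab : a ≤ K * b) (hba : b ≤ K * a) : a ^ p ≤ K ^ |p| * b ^ p := by
  have hK0 : 0 < K := by linarith
  rcases le_total 0 p with hp | hp
  · rw [abs_of_nonneg hp, ← Real.mul_rpow hK0.le hb.le]
    exact Real.rpow_le_rpow ha.le hab hp
  · rw [abs_of_nonpos hp, Real.rpow_neg hK0.le, ← Real.inv_rpow hK0.le,
      ← Real.mul_rpow (by positivity) hb.le]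
    refine Real.rpow_le_rpow_of_nonpos (by positivity) ?_ hp
    rw [inv_mul_le_iff₀ hK0]; exact hba

theorem weight_le_of_comparable {ξ η : Sp d} {K : ℝ} (p : ℝ) (hξ : ξ ≠ 0) (hη : η ≠ 0)
    (hK : 1 ≤ K) (h1 : ‖ξ‖ ≤ K * ‖η‖) (h2 : ‖η‖ ≤ K * ‖ξ‖) :
    weight p ξ ≤ ENNReal.ofReal (K ^ |p|) * weight p η := by
  rw [weight, weight, ← ENNReal.ofReal_mul (by positivity)]
  exact ENNReal.ofReal_le_ofReal (rpow_le_rpow_of_comparable p (norm_pos_iff.2 hξ)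
    (norm_pos_iff.2 hη) hK h1 h2)

theorem sq_lintegral_mul_le {α : Type*} [MeasurableSpace α] (μ : Measure α) {u v : α → ℝ≥0∞}
    (hu : AEMeasurable u μ) (hv : AEMeasurable v μ) :
    (∫⁻ x, u x * v x ∂μ) ^ 2 ≤ (∫⁻ x, u x ^ 2 ∂μ) * ∫⁻ x, v x ^ 2 ∂μ := by
  have := ENNReal.lintegral_mul_le_Lp_mul_Lq μ Real.HolderConjugate.two_two hu hv
  calc (∫⁻ x, u x * v x ∂μ) ^ 2 ≤ _ := pow_le_pow_left₀ zero_le this 2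
    _ = _ := by
      rw [mul_pow, ← ENNReal.rpow_natCast, ← ENNReal.rpow_natCast, ← ENNReal.rpow_mul,
        ← ENNReal.rpow_mul]
      simp

/-- The threshold -d is where the bounds on s, t and s + t enter: it is applied with p = -2s, -2t
and 2(s + t) - d. -/
theorem lintegral_weight_unitBall_lt_top [NeZero d] {p : ℝ} (hp : -(d : ℝ) < p) :
    ∫⁻ ξ in Metric.closedBall (0 : Sp d) 1, weight p ξ < ⊤ := by
  have h : IntegrableOn (fun ξ : Sp d => ‖ξ‖ ^ p) (Metric.ball (0 : Sp d) 2) := by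
    refine integrableOn_ball_of_norm_le_rpow (C := 1) (α := -p) ?_ ?_ (.of_forall fun ξ => ?_)
      (measurable_norm.pow_const p).aestronglyMeasurable
    · simpa using NeZero.one_le
    · simp; linarith
    · simp [abs_of_nonneg (Real.rpow_nonneg (norm_nonneg ξ) p)]
  refine (lintegral_mono_set (Metric.closedBall_subset_ball one_lt_two)).trans_lt ?_
  have := h.hasFiniteIntegral
  rw [hasFiniteIntegral_iff_ofReal (.of_forall fun ξ => by positivity)] at this
  exact this

/-- The integral of a power weight over the unit ball. -/
def ballConst (d : ℕ) (p : ℝ) : ℝ≥0∞ := ∫⁻ ξ in Metric.closedBall (0 : Sp d) 1, weight p ξ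

/-- Dilation by R. No condition on p is needed, since both sides may be infinite. -/
theorem lintegral_weight_closedBall (p : ℝ) {R : ℝ} (hR : 0 < R) :
    ∫⁻ ξ in Metric.closedBall (0 : Sp d) R, weight p ξ =
      ballConst d p * ENNReal.ofReal (R ^ (p + d)) := by
  have hm := Measure.map_addHaar_smul (volume : Measure (Sp d)) hR.ne'
  set g : Sp d → ℝ≥0∞ := (Metric.closedBall (0 : Sp d) R).indicator (weight p) with hg
  have hgm : Measurable g := (measurable_weight p).indicator Metric.isClosed_closedBall.measurableSet
  have h1 : ∫⁻ ξ, g (R • ξ) = ENNReal.ofReal ((R ^ d)⁻¹) * ∫⁻ ξ, g ξ := by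
    rw [← lintegral_map hgm (by fun_prop), hm, lintegral_smul_measure]
    simp [abs_of_pos hR]
  have h2 : ∀ ξ, g (R • ξ) = ENNReal.ofReal (R ^ p) *
      (Metric.closedBall (0 : Sp d) 1).indicator (weight p) ξ := by
    intro ξ
    have : R • ξ ∈ Metric.closedBall (0 : Sp d) R ↔ ξ ∈ Metric.closedBall (0 : Sp d) 1 := by
      simp [norm_smul, abs_of_pos hR, hR]
    by_cases h : ξ ∈ Metric.closedBall (0 : Sp d) 1
    · rw [hg, Set.indicator_of_mem (this.2 h), Set.indicator_of_mem h, weight, weight,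
        ← ENNReal.ofReal_mul (by positivity), norm_smul, Real.mul_rpow (by positivity)
        (by positivity), Real.norm_of_nonneg hR.le]
    · rw [hg, Set.indicator_of_notMem (mt this.1 h), Set.indicator_of_notMem h, mul_zero]
  simp_rw [h2] at h1
  rw [lintegral_const_mul _ ((measurable_weight p).indicator
    Metric.isClosed_closedBall.measurableSet), hg, lintegral_indicator
    Metric.isClosed_closedBall.measurableSet, lintegral_indicator
    Metric.isClosed_closedBall.measurableSet] at h1
  have h3 := congrArg (fun x => ENNReal.ofReal (R ^ d) * x) h1
  simp only [← mul_assoc, ← ENNReal.ofReal_mul (pow_nonneg hR.le d)] at h3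
  rw [mul_inv_cancel₀ (by positivity), ENNReal.ofReal_one, one_mul] at h3
  rw [← h3, ballConst, mul_comm, Real.rpow_add hR, mul_comm (R ^ p), Real.rpow_natCast]

/-! ### The weighted convolution estimate -/

/-- The square of the weighted `L²` norm `‖ |ξ|^r F ‖`. -/
def weightedNormSq (r : ℝ) (F : Sp d → ℝ≥0∞) : ℝ≥0∞ := ∫⁻ ξ, weight (2 * r) ξ * F ξ ^ 2

theorem lintegral_lintegral_mul_sub {A B : Sp d → ℝ≥0∞} (hA : Measurable A) (hB : Measurable B) :
    ∫⁻ ζ, ∫⁻ ξ, A ξ * B (ζ - ξ) = (∫⁻ ξ, A ξ) * ∫⁻ η, B η := by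
  rw [lintegral_lintegral_swap (by fun_prop)]
  rw [← lintegral_mul_const _ hA]
  refine lintegral_congr fun ξ => ?_
  rw [lintegral_const_mul _ (by fun_prop), lintegral_sub_right_eq_self B ξ]

theorem ae_ne_zero [NeZero d] : ∀ᵐ ξ : Sp d, ξ ≠ 0 := by
  simp [ae_iff]

theorem norm_sub_comparable {ξ ζ : Sp d} (h : 2 * ‖ξ‖ ≤ ‖ζ‖) :
    ‖ζ‖ ≤ 2 * ‖ζ - ξ‖ ∧ ‖ζ - ξ‖ ≤ 2 * ‖ζ‖ := by
  have h1 := norm_sub_norm_le ζ ξ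
  have h2 := norm_sub_le ζ ξ
  have h3 := norm_nonneg ξ
  constructor <;> linarith

/-- Here |ζ - ξ| is comparable to |ζ|. Cauchy-Schwarz with the weights |ξ|^(-s) and |ξ|^s produces
the integral of |ξ|^(-2s) over a ball of radius |ζ|, a multiple of |ζ|^(d - 2s). This leaves
|ζ|^(2t), which is moved onto G(ζ - ξ), and Tonelli concludes. -/
theorem weightedNormSq_low_le [NeZero d] (s t : ℝ) {F G : Sp d → ℝ≥0∞}
    (hF : Measurable F) (hG : Measurable G) :
    ∫⁻ ζ, weight (2 * (s + t - d / 2)) ζ *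
        (∫⁻ ξ in {ξ | 2 * ‖ξ‖ ≤ ‖ζ‖}, F ξ * G (ζ - ξ)) ^ 2 ≤
      ballConst d (-(2 * s)) * ENNReal.ofReal (2 ^ |2 * t|) *
        (weightedNormSq s F * weightedNormSq t G) := by
  rw [weightedNormSq, weightedNormSq, ← lintegral_lintegral_mul_sub (by fun_prop) (by fun_prop),
    ← lintegral_const_mul _ (by fun_prop)]
  refine lintegral_mono_ae ?_
  filter_upwards [ae_ne_zero] with ζ hζ
  have hcs : (∫⁻ ξ in {ξ | 2 * ‖ξ‖ ≤ ‖ζ‖}, F ξ * G (ζ - ξ)) ^ 2 ≤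
      (∫⁻ ξ in {ξ : Sp d | 2 * ‖ξ‖ ≤ ‖ζ‖}, weight (-s) ξ ^ 2) *
        ∫⁻ ξ in {ξ | 2 * ‖ξ‖ ≤ ‖ζ‖}, (weight s ξ * F ξ * G (ζ - ξ)) ^ 2 := by
    refine le_trans (le_of_eq ?_) (sq_lintegral_mul_le _ (by fun_prop) (by fun_prop))
    congr 1
    refine lintegral_congr_ae (ae_restrict_of_ae ?_)
    filter_upwards [ae_ne_zero] with ξ hξ
    rw [← mul_assoc, ← mul_assoc, weight_neg_mul hξ, one_mul]
  have h1 : ∫⁻ ξ in {ξ : Sp d | 2 * ‖ξ‖ ≤ ‖ζ‖}, weight (-s) ξ ^ 2 ≤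
      ballConst d (-(2 * s)) * weight (-(2 * s) + d) ζ := by
    rw [weight, ← lintegral_weight_closedBall _ (norm_pos_iff.2 hζ)]
    refine le_trans (lintegral_mono_set (t := Metric.closedBall 0 ‖ζ‖) fun ξ hξ => ?_) (le_of_eq ?_)
    · have : 2 * ‖ξ‖ ≤ ‖ζ‖ := hξ
      simp only [mem_closedBall_zero_iff]
      linarith [norm_nonneg ξ]
    · refine lintegral_congr_ae (ae_restrict_of_ae ?_)
      filter_upwards [ae_ne_zero] with ξ hξ
      rw [weight_sq hξ]; ring_nf
  have h2 : weight (2 * t) ζ * ∫⁻ ξ in {ξ | 2 * ‖ξ‖ ≤ ‖ζ‖}, (weight s ξ * F ξ * G (ζ - ξ)) ^ 2 ≤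
      ENNReal.ofReal (2 ^ |2 * t|) *
        ∫⁻ ξ, weight (2 * s) ξ * F ξ ^ 2 * (weight (2 * t) (ζ - ξ) * G (ζ - ξ) ^ 2) := by
    rw [← lintegral_const_mul _ (by fun_prop), ← lintegral_const_mul _ (by fun_prop)]
    refine le_trans (setLIntegral_mono_ae (by fun_prop) ?_) (setLIntegral_le_lintegral _ _)
    filter_upwards [ae_ne_zero] with ξ hξ hS
    obtain ⟨h3, h4⟩ := norm_sub_comparable hS
    have h5 : ζ - ξ ≠ 0 := by
      intro h; rw [h, norm_zero, mul_zero] at h3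
      exact hζ (norm_le_zero_iff.1 h3)
    rw [mul_pow, mul_pow, weight_sq hξ]
    calc _ ≤ ENNReal.ofReal (2 ^ |2 * t|) * weight (2 * t) (ζ - ξ) *
          (weight (2 * s) ξ * F ξ ^ 2 * G (ζ - ξ) ^ 2) := by
          gcongr
          exact weight_le_of_comparable _ hζ h5 one_le_two h3 h4
      _ = _ := by ring
  calc _ ≤ weight (2 * (s + t - d / 2)) ζ * (ballConst d (-(2 * s)) * weight (-(2 * s) + d) ζ *
        ∫⁻ ξ in {ξ | 2 * ‖ξ‖ ≤ ‖ζ‖}, (weight s ξ * F ξ * G (ζ - ξ)) ^ 2) := by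
        gcongr; exact hcs.trans (by gcongr)
    _ = ballConst d (-(2 * s)) * ((weight (2 * (s + t - d / 2)) ζ * weight (-(2 * s) + d) ζ) *
        ∫⁻ ξ in {ξ | 2 * ‖ξ‖ ≤ ‖ζ‖}, (weight s ξ * F ξ * G (ζ - ξ)) ^ 2) := by ring
    _ = ballConst d (-(2 * s)) * (weight (2 * t) ζ *
        ∫⁻ ξ in {ξ | 2 * ‖ξ‖ ≤ ‖ζ‖}, (weight s ξ * F ξ * G (ζ - ξ)) ^ 2) := by
        -- The exponents add up: 2(s + t - d/2) + (d - 2s) = 2t.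
        rw [weight_mul hζ]; ring_nf
    _ ≤ _ := by rw [mul_assoc]; gcongr

/-- Here |ξ| and |ζ - ξ| are comparable, while ζ can be much smaller than both. Cauchy-Schwarz with
the weights |ξ|^(-t) and |ξ|^t isolates the norm of G. The remaining factor is integrated in ζ
first, over |ζ| ≤ 2|ξ|, which turns the outer weight into a multiple of |ξ|^(2(s + t)). -/
theorem weightedNormSq_high_le [NeZero d] (s t : ℝ) {F G : Sp d → ℝ≥0∞}
    (hF : Measurable F) (hG : Measurable G) :
    ∫⁻ ζ, weight (2 * (s + t - d / 2)) ζ *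
        (∫⁻ ξ in {ξ | ‖ζ‖ ≤ 2 * ‖ξ‖ ∧ ‖ζ‖ ≤ 2 * ‖ζ - ξ‖}, F ξ * G (ζ - ξ)) ^ 2 ≤
      ENNReal.ofReal (3 ^ |2 * t|) * (ballConst d (2 * (s + t - d / 2)) *
        ENNReal.ofReal (2 ^ (2 * (s + t)))) * (weightedNormSq s F * weightedNormSq t G) := by
  set S : Sp d → Set (Sp d) := fun ζ => {ξ | ‖ζ‖ ≤ 2 * ‖ξ‖ ∧ ‖ζ‖ ≤ 2 * ‖ζ - ξ‖} with hSdef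
  have hS : ∀ ζ, MeasurableSet (S ζ) := fun ζ =>
    (measurableSet_le (f := fun _ => ‖ζ‖) (g := fun ξ : Sp d => 2 * ‖ξ‖) (by fun_prop)
      (by fun_prop)).inter (measurableSet_le (f := fun _ => ‖ζ‖)
      (g := fun ξ : Sp d => 2 * ‖ζ - ξ‖) (by fun_prop) (by fun_prop))
  have hT : MeasurableSet {x : Sp d × Sp d | ‖x.1‖ ≤ 2 * ‖x.2‖} :=
    measurableSet_le (by fun_prop) (by fun_prop)
  -- In the first factor only |ζ| ≤ 2|ξ| is kept, so that for fixed ξ the variable ζ ranges over a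
  -- ball; the second factor is bounded independently of ζ.
  have hcs : ∀ ζ : Sp d, ζ ≠ 0 → (∫⁻ ξ in S ζ, F ξ * G (ζ - ξ)) ^ 2 ≤
      (∫⁻ ξ, {x : Sp d × Sp d | ‖x.1‖ ≤ 2 * ‖x.2‖}.indicator
        (fun x => weight (-(2 * t)) x.2 * F x.2 ^ 2) (ζ, ξ)) *
        (ENNReal.ofReal (3 ^ |2 * t|) * weightedNormSq t G) := by
    intro ζ hζ
    calc (∫⁻ ξ in S ζ, F ξ * G (ζ - ξ)) ^ 2
        = (∫⁻ ξ in S ζ, (weight (-t) ξ * F ξ) * (weight t ξ * G (ζ - ξ))) ^ 2 := by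
          congr 1
          refine lintegral_congr_ae (ae_restrict_of_ae ?_)
          filter_upwards [ae_ne_zero] with ξ hξ
          rw [mul_mul_mul_comm, weight_neg_mul hξ, one_mul]
      _ ≤ (∫⁻ ξ in S ζ, (weight (-t) ξ * F ξ) ^ 2) * ∫⁻ ξ in S ζ, (weight t ξ * G (ζ - ξ)) ^ 2 :=
          sq_lintegral_mul_le _ (by fun_prop) (by fun_prop)
      _ ≤ _ := by
          gcongr ?_ * ?_
          · rw [← lintegral_indicator (hS ζ)]
            refine lintegral_mono_ae ?_
            filter_upwards [ae_ne_zero] with ξ hξ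
            refine Set.indicator_apply_le' (fun hm => ?_) (fun _ => zero_le)
            rw [Set.indicator_of_mem (show (ζ, ξ) ∈ {x : Sp d × Sp d | ‖x.1‖ ≤ 2 * ‖x.2‖} from hm.1),
              mul_pow, weight_sq hξ, mul_neg]
          · rw [weightedNormSq, ← lintegral_sub_left_eq_self (fun ξ => weight (2 * t) ξ * G ξ ^ 2) ζ,
              ← lintegral_const_mul _ (by fun_prop)]
            refine le_trans (setLIntegral_mono_ae (by fun_prop) ?_) (setLIntegral_le_lintegral _ _)
            filter_upwards [ae_ne_zero] with ξ hξ hm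
            have e1 := norm_sub_le ζ ξ
            have e2 : ‖ξ‖ ≤ ‖ζ‖ + ‖ζ - ξ‖ := by simpa using norm_sub_le ζ (ζ - ξ)
            have h5 : ζ - ξ ≠ 0 := by
              intro h
              have := hm.2
              rw [h, norm_zero, mul_zero] at this
              exact hζ (norm_le_zero_iff.1 this)
            rw [mul_pow, weight_sq hξ, ← mul_assoc]
            gcongr
            -- The constant 3: |ξ| ≤ |ζ| + |ζ - ξ| ≤ 3|ζ - ξ|, and symmetrically.
            exact weight_le_of_comparable _ hξ h5 (by norm_num) (by linarith [hm.2])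
              (by linarith [hm.1])
  have hmeas : Measurable ({x : Sp d × Sp d | ‖x.1‖ ≤ 2 * ‖x.2‖}.indicator
        (fun x => weight (-(2 * t)) x.2 * F x.2 ^ 2)) :=
    Measurable.indicator (by fun_prop) hT
  calc _ ≤ ∫⁻ ζ, (∫⁻ ξ, weight (2 * (s + t - d / 2)) ζ *
        {x : Sp d × Sp d | ‖x.1‖ ≤ 2 * ‖x.2‖}.indicator
        (fun x => weight (-(2 * t)) x.2 * F x.2 ^ 2) (ζ, ξ)) *
        (ENNReal.ofReal (3 ^ |2 * t|) * weightedNormSq t G) := by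
        refine lintegral_mono_ae ?_
        filter_upwards [ae_ne_zero] with ζ hζ
        rw [lintegral_const_mul _ (by fun_prop), mul_assoc]
        gcongr
        exact hcs ζ hζ
    _ = (∫⁻ ξ, ∫⁻ ζ, weight (2 * (s + t - d / 2)) ζ *
        {x : Sp d × Sp d | ‖x.1‖ ≤ 2 * ‖x.2‖}.indicator
        (fun x => weight (-(2 * t)) x.2 * F x.2 ^ 2) (ζ, ξ)) *
        (ENNReal.ofReal (3 ^ |2 * t|) * weightedNormSq t G) := by
        rw [lintegral_mul_const _ (Measurable.lintegral_prod_right (by fun_prop)),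
          lintegral_lintegral_swap (by fun_prop)]
    _ = (∫⁻ ξ, (ballConst d (2 * (s + t - d / 2)) * ENNReal.ofReal (2 ^ (2 * (s + t)))) *
        (weight (2 * s) ξ * F ξ ^ 2)) * (ENNReal.ofReal (3 ^ |2 * t|) * weightedNormSq t G) := by
        congr 1
        refine lintegral_congr_ae ?_
        filter_upwards [ae_ne_zero] with ξ hξ
        have e : ∀ ζ, weight (2 * (s + t - d / 2)) ζ *
            {x : Sp d × Sp d | ‖x.1‖ ≤ 2 * ‖x.2‖}.indicator
            (fun x => weight (-(2 * t)) x.2 * F x.2 ^ 2) (ζ, ξ) =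
            (Metric.closedBall 0 (2 * ‖ξ‖)).indicator (weight (2 * (s + t - d / 2))) ζ *
            (weight (-(2 * t)) ξ * F ξ ^ 2) := by
          intro ζ
          by_cases h : ‖ζ‖ ≤ 2 * ‖ξ‖
          · rw [Set.indicator_of_mem (by exact h), Set.indicator_of_mem (by simpa using h)]
          · rw [Set.indicator_of_notMem (by exact h), Set.indicator_of_notMem (by simpa using h)]
            simp
        have hpos := norm_pos_iff.2 hξ
        simp_rw [e]
        rw [lintegral_mul_const _ ((measurable_weight _).indicator
          Metric.isClosed_closedBall.measurableSet), lintegral_indicator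
          Metric.isClosed_closedBall.measurableSet, lintegral_weight_closedBall _ (by positivity)]
        have e2 : ENNReal.ofReal ((2 * ‖ξ‖) ^ (2 * (s + t - d / 2) + d)) =
            ENNReal.ofReal (2 ^ (2 * (s + t))) * weight (2 * (s + t)) ξ := by
          rw [weight, ← ENNReal.ofReal_mul (by positivity), ← Real.mul_rpow (by norm_num) hpos.le]
          ring_nf
        rw [e2, mul_assoc, mul_assoc, mul_assoc, ← mul_assoc (weight (2 * (s + t)) ξ),
          weight_mul hξ]
        ring_nf
    _ = _ := by
        rw [lintegral_const_mul _ (by fun_prop), weightedNormSq, weightedNormSq]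
        ring

theorem add_add_sq_le (a b c : ℝ≥0∞) : (a + b + c) ^ 2 ≤ 3 * (a ^ 2 + b ^ 2 + c ^ 2) := by
  by_cases ha : a = ⊤
  · simp [ha]
  by_cases hb : b = ⊤
  · simp [hb]
  by_cases hc : c = ⊤
  · simp [hc]
  lift a to NNReal using ha
  lift b to NNReal using hb
  lift c to NNReal using hc
  norm_cast
  rw [← NNReal.coe_le_coe]
  push_cast
  nlinarith [sq_nonneg ((a : ℝ) - b), sq_nonneg ((b : ℝ) - c), sq_nonneg ((a : ℝ) - c)]

/-- The three regions cover all ξ, and the second is the first with F and G exchanged. The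
hypotheses on s and t serve only to make the three constants finite. -/
theorem exists_weightedNormSq_conv_le [NeZero d] (s t : ℝ) (hs : |s| < (d : ℝ) / 2)
    (ht : |t| < (d : ℝ) / 2) (hst : 0 < s + t) :
    ∃ C : ℝ≥0∞, C ≠ ⊤ ∧ ∀ F G : Sp d → ℝ≥0∞, Measurable F → Measurable G →
      weightedNormSq (s + t - d / 2) (fun ζ => ∫⁻ ξ, F ξ * G (ζ - ξ)) ≤
        C * (weightedNormSq s F * weightedNormSq t G) := by
  obtain ⟨hs1, hs2⟩ := abs_lt.1 hs
  obtain ⟨ht1, ht2⟩ := abs_lt.1 ht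
  set C₁ := ballConst d (-(2 * s)) * ENNReal.ofReal (2 ^ |2 * t|)
  set C₂ := ballConst d (-(2 * t)) * ENNReal.ofReal (2 ^ |2 * s|)
  set C₃ := ENNReal.ofReal (3 ^ |2 * t|) * (ballConst d (2 * (s + t - d / 2)) *
        ENNReal.ofReal (2 ^ (2 * (s + t))))
  refine ⟨3 * (C₁ + C₂ + C₃), ?_, fun F G hF hG => ?_⟩
  · have k1 : ballConst d (-(2 * s)) ≠ ⊤ := (lintegral_weight_unitBall_lt_top (by linarith)).ne
    have k2 : ballConst d (-(2 * t)) ≠ ⊤ := (lintegral_weight_unitBall_lt_top (by linarith)).ne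
    have k3 : ballConst d (2 * (s + t - d / 2)) ≠ ⊤ :=
      (lintegral_weight_unitBall_lt_top (by linarith)).ne
    simp only [C₁, C₂, C₃]
    finiteness
  · have e1 := weightedNormSq_low_le s t hF hG
    have e2 := weightedNormSq_low_le t s hG hF
    have e3 := weightedNormSq_high_le s t hF hG
    rw [add_comm t s, mul_comm (weightedNormSq t G)] at e2
    have hpt : ∀ ζ : Sp d, ∫⁻ ξ, F ξ * G (ζ - ξ) ≤
        (∫⁻ ξ in {ξ | 2 * ‖ξ‖ ≤ ‖ζ‖}, F ξ * G (ζ - ξ)) +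
        (∫⁻ ξ in {ξ | 2 * ‖ξ‖ ≤ ‖ζ‖}, G ξ * F (ζ - ξ)) +
        ∫⁻ ξ in {ξ | ‖ζ‖ ≤ 2 * ‖ξ‖ ∧ ‖ζ‖ ≤ 2 * ‖ζ - ξ‖}, F ξ * G (ζ - ξ) := by
      intro ζ
      have hsub : ∫⁻ ξ in {ξ | 2 * ‖ξ‖ ≤ ‖ζ‖}, G ξ * F (ζ - ξ) =
          ∫⁻ ξ in {ξ | 2 * ‖ζ - ξ‖ ≤ ‖ζ‖}, F ξ * G (ζ - ξ) := by
        rw [← lintegral_indicator (measurableSet_le (by fun_prop) (by fun_prop)),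
          ← lintegral_indicator (measurableSet_le (by fun_prop) (by fun_prop)),
          ← lintegral_sub_left_eq_self _ ζ]
        refine lintegral_congr fun ξ => ?_
        simp only [Set.indicator, Set.mem_ofPred_eq, sub_sub_cancel, mul_comm]
      rw [hsub]
      refine le_trans ?_ ((lintegral_union_le _ _ _).trans
        (add_le_add_left (lintegral_union_le _ _ _) _))
      rw [← setLIntegral_univ]
      refine lintegral_mono_set fun ξ _ => ?_
      simp only [Set.mem_union, Set.mem_ofPred_eq]
      by_contra! h
      linarith [h.2 h.1.1.le, h.1.2]
    have m1 : ∀ F G : Sp d → ℝ≥0∞, Measurable F → Measurable G →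
        Measurable fun ζ : Sp d => weight (2 * (s + t - d / 2)) ζ *
          (∫⁻ ξ in {ξ | 2 * ‖ξ‖ ≤ ‖ζ‖}, F ξ * G (ζ - ξ)) ^ 2 := by
      intro F G hF hG
      refine (measurable_weight _).mul (Measurable.pow_const ?_ _)
      have : Measurable (Function.uncurry fun ζ ξ : Sp d =>
          {x : Sp d × Sp d | 2 * ‖x.2‖ ≤ ‖x.1‖}.indicator (fun x => F x.2 * G (x.1 - x.2)) (ζ, ξ)) :=
        Measurable.indicator (by fun_prop) (measurableSet_le (by fun_prop) (by fun_prop))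
      convert this.lintegral_prod_right (ν := volume) using 2 with ζ
      rw [← lintegral_indicator (measurableSet_le (by fun_prop) (by fun_prop))]
      rfl
    calc weightedNormSq (s + t - d / 2) (fun ζ => ∫⁻ ξ, F ξ * G (ζ - ξ))
        ≤ ∫⁻ ζ, 3 * (weight (2 * (s + t - d / 2)) ζ *
            (∫⁻ ξ in {ξ | 2 * ‖ξ‖ ≤ ‖ζ‖}, F ξ * G (ζ - ξ)) ^ 2 +
          weight (2 * (s + t - d / 2)) ζ *
            (∫⁻ ξ in {ξ | 2 * ‖ξ‖ ≤ ‖ζ‖}, G ξ * F (ζ - ξ)) ^ 2 +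
          weight (2 * (s + t - d / 2)) ζ *
            (∫⁻ ξ in {ξ | ‖ζ‖ ≤ 2 * ‖ξ‖ ∧ ‖ζ‖ ≤ 2 * ‖ζ - ξ‖}, F ξ * G (ζ - ξ)) ^ 2) := by
          refine lintegral_mono fun ζ => ?_
          rw [← mul_add, ← mul_add, mul_left_comm]
          gcongr
          exact (pow_le_pow_left₀ zero_le (hpt ζ) 2).trans (add_add_sq_le _ _ _)
      _ ≤ 3 * (C₁ * (weightedNormSq s F * weightedNormSq t G) +
            C₂ * (weightedNormSq s F * weightedNormSq t G) +
            C₃ * (weightedNormSq s F * weightedNormSq t G)) := by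
          rw [lintegral_const_mul' _ _ (by simp), lintegral_add_left (by
            exact (m1 F G hF hG).add (m1 G F hG hF)), lintegral_add_left (m1 F G hF hG)]
          gcongr
      _ = _ := by ring

/-! ### Removal of cut-offs in the Schwartz space -/

/-- At order zero the Lipschitz bound gives ε|x|, which accounts for the growth in x. At positive
order the chain rule gives a power of ε that is at most ε. -/
theorem exists_norm_iteratedFDeriv_cutoff_sub_one_le {θ : Sp d → ℂ} (h1 : ContDiff ℝ ∞ θ)
    (h2 : HasCompactSupport θ) (h3 : θ 0 = 1) (i : ℕ) :
    ∃ K, 0 ≤ K ∧ ∀ ε, 0 < ε → ε ≤ 1 → ∀ x : Sp d,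
      ‖iteratedFDeriv ℝ i (fun y => θ (ε • y) - 1) x‖ ≤ ε * K * (1 + ‖x‖) := by
  rcases i with _ | i
  · obtain ⟨K, hK⟩ := h1.lipschitzWith_of_hasCompactSupport h2 (by simp)
    refine ⟨K, K.2, fun ε hε _ x => ?_⟩
    rw [norm_iteratedFDeriv_zero, ← h3]
    have := hK.norm_sub_le (ε • x) 0
    rw [sub_zero, norm_smul, Real.norm_of_nonneg hε.le] at this
    have h4 : 0 ≤ ε * K := by positivity
    nlinarith
  · obtain ⟨K, hK⟩ := (h2.iteratedFDeriv (𝕜 := ℝ) (i + 1)).exists_bound_of_continuous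
      (h1.continuous_iteratedFDeriv (m := i + 1) (by exact_mod_cast le_top))
    have hK0 : 0 ≤ K := (norm_nonneg _).trans (hK 0)
    refine ⟨K, hK0, fun ε hε hε1 x => ?_⟩
    have h4 : ContDiff ℝ ((i + 1 : ℕ) : ℕ∞ω) θ := h1.of_le (by exact_mod_cast le_top)
    have h5 : ContDiff ℝ ((i + 1 : ℕ) : ℕ∞ω) (fun y => θ (ε • y)) := h4.comp (by fun_prop)
    rw [show (fun y => θ (ε • y) - 1) = (fun y => θ (ε • y)) - fun _ => (1 : ℂ) from rfl,
      iteratedFDeriv_sub h5 contDiff_const, iteratedFDeriv_succ_const]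
    simp only [sub_zero]
    rw [iteratedFDeriv_comp_const_smul _ h4, norm_smul, norm_pow, Real.norm_of_nonneg hε.le]
    have h6 : ε ^ (i + 1) ≤ ε := pow_le_of_le_one hε.le hε1 (by simp)
    calc _ ≤ ε * K := by gcongr; exact hK _
      _ ≤ _ := le_mul_of_one_le_right (by positivity) (by linarith [norm_nonneg x])

/-- `θ(ε ·) v → v` in the Schwartz space as `ε → 0+`. -/
theorem tendsto_cutoff_smul {θ : Sp d → ℂ} (h1 : ContDiff ℝ ∞ θ) (h2 : HasCompactSupport θ)
    (h3 : θ 0 = 1) (v : 𝓢(Sp d, ℂ)) :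
    Tendsto (fun ε : ℝ => SchwartzMap.smulLeftCLM ℂ (fun ξ => θ (ε • ξ)) v) (𝓝[>] 0) (𝓝 v) := by
  rw [(schwartz_withSeminorms ℂ (Sp d) ℂ).tendsto_nhds]
  rintro ⟨k, n⟩ δ hδ
  choose K hK0 hK using exists_norm_iteratedFDeriv_cutoff_sub_one_le h1 h2 h3
  -- The factor 1 + |x| in the cut-off bound costs one power of |x|, hence the seminorms of index k
  -- + 1.
  set C : ℝ := ∑ i ∈ Finset.range (n + 1), (n.choose i : ℝ) * K i *
    (SchwartzMap.seminorm ℂ k (n - i) v + SchwartzMap.seminorm ℂ (k + 1) (n - i) v) with hC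
  have hC0 : 0 ≤ C := Finset.sum_nonneg fun i _ => by have := hK0 i; positivity
  have key : ∀ ε, 0 < ε → ε ≤ 1 → SchwartzMap.seminorm ℂ k n
      (SchwartzMap.smulLeftCLM ℂ (fun ξ => θ (ε • ξ)) v - v) ≤ ε * C := by
    intro ε hε hε1
    refine SchwartzMap.seminorm_le_bound ℂ k n _ (by positivity) fun x => ?_
    have e : ⇑(SchwartzMap.smulLeftCLM ℂ (fun ξ => θ (ε • ξ)) v - v) =
        fun x => (θ (ε • x) - 1) * v x := by
      ext x
      simp [SchwartzMap.smulLeftCLM_apply_apply (cutoff_scale h1 h2 ε), sub_mul]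
    have hg : ContDiff ℝ ∞ (fun y => θ (ε • y) - 1) := (h1.comp (by fun_prop)).sub contDiff_const
    rw [e]
    have := norm_iteratedFDeriv_mul_le hg (v.smooth ⊤) x (n := n)
      (by exact_mod_cast le_top)
    calc _ ≤ ‖x‖ ^ k * ∑ i ∈ Finset.range (n + 1), (n.choose i : ℝ) *
          (ε * K i * (1 + ‖x‖)) * ‖iteratedFDeriv ℝ (n - i) v x‖ := by
          gcongr
          refine this.trans (Finset.sum_le_sum fun i _ => ?_)
          gcongr
          exact hK i ε hε hε1 x
      _ = ε * ∑ i ∈ Finset.range (n + 1), (n.choose i : ℝ) * K i *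
          (‖x‖ ^ k * ‖iteratedFDeriv ℝ (n - i) v x‖ +
            ‖x‖ ^ (k + 1) * ‖iteratedFDeriv ℝ (n - i) v x‖) := by
          rw [Finset.mul_sum, Finset.mul_sum]
          refine Finset.sum_congr rfl fun i _ => ?_
          ring
      _ ≤ _ := by
          rw [hC]
          gcongr with i
          · have := hK0 i; positivity
          · exact SchwartzMap.le_seminorm ℂ _ _ v x
          · exact SchwartzMap.le_seminorm ℂ _ _ v x
  have h0 : Tendsto (fun ε : ℝ => ε * C) (𝓝[>] 0) (𝓝 0) := by
    have : Tendsto (fun ε : ℝ => ε * C) (𝓝 0) (𝓝 (0 * C)) := (continuous_mul_const C).tendsto 0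
    rw [zero_mul] at this
    exact this.mono_left nhdsWithin_le_nhds
  filter_upwards [self_mem_nhdsWithin, mem_nhdsWithin_of_mem_nhds (Iic_mem_nhds one_pos),
    h0.eventually (gt_mem_nhds hδ)] with ε e1 e2 e3
  exact (key ε e1 e2).trans_lt e3

/-! ### Distributions whose Fourier transform is a function -/

/-- The Fourier transform of `u` is the function `f`. -/
structure HasFourierDensity (u : 𝓢'(Sp d, ℂ)) (f : Sp d → ℂ) : Prop where
  measurable : Measurable f
  integrable : ∀ v : 𝓢(Sp d, ℂ), Integrable fun ξ => v ξ * f ξ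
  fourier_apply : ∀ v : 𝓢(Sp d, ℂ), 𝓕 u v = ∫ ξ, v ξ * f ξ

/-- A rapidly decreasing weight whose inverse has temperate growth. -/
def decay (ξ : Sp d) : ℝ := (1 + ‖ξ‖ ^ 2) ^ (-((d : ℝ) + 1))

theorem decay_pos (ξ : Sp d) : 0 < decay ξ := by unfold decay; positivity

theorem decay_le_one (ξ : Sp d) : decay ξ ≤ 1 :=
  Real.rpow_le_one_of_one_le_of_nonpos (by nlinarith [norm_nonneg ξ]) (by linarith [d.cast_nonneg (α := ℝ)])

@[fun_prop]
theorem continuous_decay : Continuous (decay : Sp d → ℝ) := by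
  unfold decay
  exact Continuous.rpow_const (by fun_prop) fun ξ => Or.inl (by positivity)

theorem inv_decay_hasTemperateGrowth :
    (fun ξ : Sp d => (((decay ξ)⁻¹ : ℝ) : ℂ)).HasTemperateGrowth := by
  have : (fun ξ : Sp d => (decay ξ)⁻¹) = fun ξ => (1 + ‖ξ‖ ^ 2) ^ ((d : ℝ) + 1) := by
    ext ξ; rw [decay, Real.rpow_neg (by positivity), inv_inv]
  have h := Function.hasTemperateGrowth_one_add_norm_sq_rpow (Sp d) ((d : ℝ) + 1)
  rw [← this] at h
  exact Function.HasTemperateGrowth.comp (g := Complex.ofReal) (by fun_prop) h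

/-- Dividing a Schwartz function by `decay` leaves a Schwartz function, in particular a bounded one.
-/
theorem integrable_schwartz_mul {f : Sp d → ℂ}
    (hi : Integrable fun ξ => (decay ξ : ℂ) * f ξ) (v : 𝓢(Sp d, ℂ)) :
    Integrable fun ξ => v ξ * f ξ := by
  set w := SchwartzMap.smulLeftCLM ℂ (fun ξ : Sp d => (((decay ξ)⁻¹ : ℝ) : ℂ)) v with hw
  have e : (fun ξ => v ξ * f ξ) = fun ξ => w ξ * ((decay ξ : ℂ) * f ξ) := by
    ext ξ
    have : (decay ξ : ℂ) ≠ 0 := by exact_mod_cast (decay_pos ξ).ne'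
    rw [hw, SchwartzMap.smulLeftCLM_apply_apply inv_decay_hasTemperateGrowth]
    push_cast
    simp only [smul_eq_mul]
    field_simp
  rw [e]
  refine hi.bdd_mul (c := SchwartzMap.seminorm ℂ 0 0 w) w.continuous.aestronglyMeasurable
    (.of_forall fun ξ => SchwartzMap.norm_le_seminorm ℂ w ξ)

theorem exists_hasFourierDensity {f : Sp d → ℂ} (hf : Measurable f)
    (hi : Integrable fun ξ => (decay ξ : ℂ) * f ξ) : ∃ u, HasFourierDensity u f := by
  have hg : MemLp (fun ξ => (decay ξ : ℂ) * f ξ) 1 := memLp_one_iff_integrable.2 hi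
  refine ⟨𝓕⁻ (TemperedDistribution.smulLeftCLM ℂ (fun ξ : Sp d => (((decay ξ)⁻¹ : ℝ) : ℂ))
    (Lp.toTemperedDistribution (hg.toLp))), hf, integrable_schwartz_mul hi, fun v => ?_⟩
  rw [FourierTransform.fourier_fourierInv_eq, TemperedDistribution.smulLeftCLM_apply_apply,
    Lp.toTemperedDistribution_apply]
  refine integral_congr_ae ?_
  filter_upwards [hg.coeFn_toLp] with ξ hξ
  have : (decay ξ : ℂ) ≠ 0 := by exact_mod_cast (decay_pos ξ).ne'
  rw [hξ, SchwartzMap.smulLeftCLM_apply_apply inv_decay_hasTemperateGrowth]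
  push_cast
  simp only [smul_eq_mul]
  field_simp

/-- The upper bound on r gives integrability at the origin. Outside the unit ball the power is
absorbed by `decay`, since 2(|r| - d - 1) is below -(d + 1)/2. -/
theorem lintegral_weight_mul_decay_sq_lt_top [NeZero d] {r : ℝ} (hr : |r| < (d : ℝ) / 2) :
    ∫⁻ ξ : Sp d, (weight (-r) ξ * ENNReal.ofReal (decay ξ)) ^ 2 < ⊤ := by
  rw [← lintegral_add_compl _ (Metric.isClosed_closedBall (x := (0 : Sp d)) (ε := 1)).measurableSet]
  refine ENNReal.add_lt_top.2 ⟨?_, ?_⟩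
  · refine lt_of_le_of_lt ?_ (lintegral_weight_unitBall_lt_top (d := d) (p := -(2 * r))
      (by linarith [(abs_lt.1 hr).2]))
    refine lintegral_mono_ae (ae_restrict_of_ae ?_)
    filter_upwards [ae_ne_zero] with ξ hξ
    rw [mul_pow, weight_sq hξ, mul_neg]
    refine mul_le_of_le_one_right zero_le (pow_le_one₀ zero_le ?_)
    exact ENNReal.ofReal_le_one.2 (decay_le_one ξ)
  · have hint := integrable_rpow_neg_one_add_norm_sq (E := Sp d) (μ := volume) (r := (d : ℝ) + 1)
      (by simp)
    have := hint.hasFiniteIntegral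
    rw [hasFiniteIntegral_iff_ofReal (.of_forall fun ξ => by positivity)] at this
    refine lt_of_le_of_lt (le_trans (setLIntegral_mono' ?_ fun ξ hξ => ?_)
      (setLIntegral_le_lintegral _ _)) this
    · exact Metric.isClosed_closedBall.measurableSet.compl
    · have h1 : 1 < ‖ξ‖ := by simpa using hξ
      have h2 : 1 ≤ 1 + ‖ξ‖ ^ 2 := by nlinarith
      rw [weight, ← ENNReal.ofReal_mul (by positivity), ← ENNReal.ofReal_pow
        (mul_nonneg (by positivity) (decay_pos ξ).le)]
      refine ENNReal.ofReal_le_ofReal ?_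
      have h3 : ‖ξ‖ ^ (-r) ≤ (1 + ‖ξ‖ ^ 2) ^ (|r|) := by
        calc ‖ξ‖ ^ (-r) ≤ ‖ξ‖ ^ |r| := Real.rpow_le_rpow_of_exponent_le h1.le (neg_le_abs r)
          _ ≤ _ := Real.rpow_le_rpow (by positivity) (by nlinarith) (abs_nonneg r)
      calc (‖ξ‖ ^ (-r) * decay ξ) ^ 2 ≤ ((1 + ‖ξ‖ ^ 2) ^ (|r|) * decay ξ) ^ 2 := by
            have := (decay_pos ξ).le
            gcongr
        _ = (1 + ‖ξ‖ ^ 2) ^ ((|r| - (d + 1)) * 2) := by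
            rw [decay, ← Real.rpow_add (by positivity), ← Real.rpow_mul_natCast (by positivity)]
            norm_num
            ring_nf
        _ ≤ _ := Real.rpow_le_rpow_of_exponent_le h2 (by linarith)

/-- Cauchy-Schwarz against |ξ|^(-r) `decay`, which is square integrable. Thus finite weighted norm
makes f a tempered density. -/
theorem integrable_decay_mul [NeZero d] {r : ℝ} (hr : |r| < (d : ℝ) / 2) {f : Sp d → ℂ}
    (hf : Measurable f) (h : weightedNormSq r (fun ξ => ‖f ξ‖ₑ) ≠ ⊤) :
    Integrable fun ξ => (decay ξ : ℂ) * f ξ := by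
  refine ⟨by fun_prop, ?_⟩
  have e : ∫⁻ ξ, ‖(decay ξ : ℂ) * f ξ‖ₑ =
      ∫⁻ ξ, (weight (-r) ξ * ENNReal.ofReal (decay ξ)) * (weight r ξ * ‖f ξ‖ₑ) := by
    refine lintegral_congr_ae ?_
    filter_upwards [ae_ne_zero] with ξ hξ
    rw [mul_mul_mul_comm, weight_neg_mul hξ, one_mul, enorm_mul, ← ofReal_norm,
      Complex.norm_of_nonneg (decay_pos ξ).le]
  have e2 : ∫⁻ ξ, (weight r ξ * ‖f ξ‖ₑ) ^ 2 = weightedNormSq r (fun ξ => ‖f ξ‖ₑ) := by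
    refine lintegral_congr_ae ?_
    filter_upwards [ae_ne_zero] with ξ hξ
    rw [mul_pow, weight_sq hξ]
  have := sq_lintegral_mul_le volume
    (u := fun ξ : Sp d => weight (-r) ξ * ENNReal.ofReal (decay ξ))
    (v := fun ξ => weight r ξ * ‖f ξ‖ₑ) (by fun_prop) (by fun_prop)
  rw [e2] at this
  rw [HasFiniteIntegral, e]
  have h2 := this.trans_lt (ENNReal.mul_lt_top (lintegral_weight_mul_decay_sq_lt_top hr) h.lt_top)
  exact (ENNReal.pow_lt_top_iff.1 h2).resolve_right (by norm_num)

theorem HasFourierDensity.multiplier {u : 𝓢'(Sp d, ℂ)} {f : Sp d → ℂ} (h : HasFourierDensity u f)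
    {m : Sp d → ℂ} (hm : m.HasTemperateGrowth) :
    HasFourierDensity (TemperedDistribution.fourierMultiplierCLM ℂ m u) (fun ξ => m ξ * f ξ) := by
  have e : ∀ (v : 𝓢(Sp d, ℂ)) ξ, SchwartzMap.smulLeftCLM ℂ m v ξ * f ξ = v ξ * (m ξ * f ξ) := by
    intro v ξ
    rw [SchwartzMap.smulLeftCLM_apply_apply hm, smul_eq_mul]; ring
  refine ⟨hm.1.continuous.measurable.mul h.measurable, fun v => ?_, fun v => ?_⟩
  · simpa only [e] using h.integrable (SchwartzMap.smulLeftCLM ℂ m v)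
  · rw [TemperedDistribution.fourierMultiplierCLM_apply, FourierTransform.fourier_fourierInv_eq,
      TemperedDistribution.smulLeftCLM_apply_apply, h.fourier_apply]
    simp only [e]

theorem HasFourierDensity.apply {u : 𝓢'(Sp d, ℂ)} {f : Sp d → ℂ} (h : HasFourierDensity u f)
    (v : 𝓢(Sp d, ℂ)) : u v = ∫ ξ, (𝓕⁻ v) ξ * f ξ := by
  rw [← h.fourier_apply, TemperedDistribution.fourier_apply, FourierTransform.fourier_fourierInv_eq]

/-! ### Dyadic rings, shells and the homogeneous partition of unity -/

/-- The symbol of the dyadic block of index `q`. -/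
def DyadicPartition.symbol (P : DyadicPartition d) (q : ℤ) (ξ : Sp d) : ℝ :=
  P.φ ((2 : ℝ) ^ (-q) • (2 * Real.pi) • ξ)

/-- The closed dyadic ring of index `q`. -/
def dyadicRing (d : ℕ) (q : ℤ) : Set (Sp d) :=
  {ξ | (2 : ℝ) ^ (q - 1) ≤ 2 * Real.pi * ‖ξ‖ ∧ 2 * Real.pi * ‖ξ‖ ≤ (2 : ℝ) ^ (q + 1)}

theorem isClosed_ring (q : ℤ) : IsClosed (dyadicRing d q) :=
  (isClosed_le (f := fun _ : Sp d => (2 : ℝ) ^ (q - 1)) (g := fun ξ : Sp d => 2 * Real.pi * ‖ξ‖)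
    (by fun_prop) (by fun_prop)).inter
  (isClosed_le (f := fun ξ : Sp d => 2 * Real.pi * ‖ξ‖) (g := fun _ : Sp d => (2 : ℝ) ^ (q + 1))
    (by fun_prop) (by fun_prop))

theorem ne_zero_of_mem_ring {q : ℤ} {ξ : Sp d} (h : ξ ∈ dyadicRing d q) : ξ ≠ 0 := by
  rintro rfl
  have := h.1
  rw [norm_zero, mul_zero] at this
  exact absurd this (not_le.2 (by positivity))

theorem DyadicPartition.mem_ring_of_symbol_ne_zero (P : DyadicPartition d) {q : ℤ} {ξ : Sp d}
    (h : P.symbol q ξ ≠ 0) : ξ ∈ dyadicRing d q := by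
  obtain ⟨h1, h2⟩ := P.φ_support _ h
  have e : ‖(2 : ℝ) ^ (-q) • (2 * Real.pi) • ξ‖ = ((2 : ℝ) ^ q)⁻¹ * (2 * Real.pi * ‖ξ‖) := by
    rw [norm_smul, norm_smul, Real.norm_of_nonneg (by positivity), Real.norm_of_nonneg (by positivity),
      zpow_neg]
  rw [e] at h1 h2
  have hq : (0 : ℝ) < 2 ^ q := by positivity
  constructor
  · rw [zpow_sub₀ (by norm_num), zpow_one]
    rw [le_inv_mul_iff₀ hq] at h1
    linarith
  · rw [zpow_add₀ (by norm_num), zpow_one]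
    rwa [inv_mul_le_iff₀ hq] at h2

theorem DyadicPartition.symbol_nonneg (P : DyadicPartition d) (q : ℤ) (ξ : Sp d) :
    0 ≤ P.symbol q ξ := P.φ_nonneg _

theorem DyadicPartition.symbol_le_one (P : DyadicPartition d) (q : ℤ) (ξ : Sp d) :
    P.symbol q ξ ≤ 1 := by
  have h := P.sum_eq ((2 : ℝ) ^ (-q) • (2 * Real.pi) • ξ)
  have h1 := le_hasSum h 0 fun _ _ => P.φ_nonneg _
  simp only [Nat.cast_zero, neg_zero, zpow_zero, one_smul] at h1
  exact h1.trans (by linarith [P.χ_nonneg ((2 : ℝ) ^ (-q) • (2 * Real.pi) • ξ)])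

theorem DyadicPartition.symbol_hasTemperateGrowth (P : DyadicPartition d) (q : ℤ) :
    (fun ξ => (P.symbol q ξ : ℂ)).HasTemperateGrowth := by
  have hc : HasCompactSupport P.φ := by
    refine HasCompactSupport.intro (isCompact_closedBall 0 2) fun ξ hξ => ?_
    by_contra h
    exact hξ (by simpa using (P.φ_support ξ h).2)
  have h1 : P.φ.HasTemperateGrowth := hc.hasTemperateGrowth P.φ_smooth
  have h2 : (P.symbol q).HasTemperateGrowth :=
    h1.comp (f := fun ξ : Sp d => (2 : ℝ) ^ (-q) • (2 * Real.pi) • ξ) (by fun_prop)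
  exact Function.HasTemperateGrowth.comp (g := Complex.ofReal) (by fun_prop) h2

/-- The index of the half-open dyadic shell that contains `ξ`. -/
def shell (ξ : Sp d) : ℤ := ⌊Real.logb 2 (2 * Real.pi * ‖ξ‖)⌋

@[fun_prop]
theorem measurable_shell : Measurable (shell : Sp d → ℤ) := by
  unfold shell Real.logb
  fun_prop

theorem zpow_shell_le {ξ : Sp d} (h : ξ ≠ 0) : (2 : ℝ) ^ shell ξ ≤ 2 * Real.pi * ‖ξ‖ := by
  have hp : 0 < 2 * Real.pi * ‖ξ‖ := by have := norm_pos_iff.2 h; positivity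
  rw [← Real.rpow_intCast, ← Real.le_logb_iff_rpow_le one_lt_two hp]
  exact Int.floor_le _

theorem lt_zpow_shell {ξ : Sp d} (h : ξ ≠ 0) : 2 * Real.pi * ‖ξ‖ < (2 : ℝ) ^ (shell ξ + 1) := by
  have hp : 0 < 2 * Real.pi * ‖ξ‖ := by have := norm_pos_iff.2 h; positivity
  rw [← Real.rpow_intCast, ← Real.logb_lt_iff_lt_rpow one_lt_two hp]
  push_cast
  exact Int.lt_floor_add_one _

/-- A ring has ratio 4 and a shell ratio 2, so at most three rings contain a given frequency. -/
theorem mem_of_mem_ring {q : ℤ} {ξ : Sp d} (h : ξ ∈ dyadicRing d q) :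
    q ∈ Finset.Icc (shell ξ - 1) (shell ξ + 1) := by
  have h0 := ne_zero_of_mem_ring h
  have h1 := (zpow_shell_le h0).trans h.2
  have h2 := h.1.trans_lt (lt_zpow_shell h0)
  rw [zpow_le_zpow_iff_right₀ one_lt_two] at h1
  rw [zpow_lt_zpow_iff_right₀ one_lt_two] at h2
  rw [Finset.mem_Icc]
  omega

theorem DyadicPartition.hasSum_symbol (P : DyadicPartition d) {ξ : Sp d} (h : ξ ≠ 0) :
    HasSum (fun q : ℤ => P.symbol q ξ) 1 := by
  -- The inhomogeneous identity is used at the point dilated by 2^N. This N pushes it outside the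
  -- unit ball, so χ vanishes there, and the indices below -N, which the identity omits, have zero
  -- symbol at ξ.
  set N : ℤ := |shell ξ| + 1 with hN
  have hs := neg_abs_le (shell ξ)
  have hpos := zpow_shell_le h
  have hy : 1 < ‖(2 : ℝ) ^ N • (2 * Real.pi) • ξ‖ := by
    rw [norm_smul, norm_smul, Real.norm_of_nonneg (by positivity), Real.norm_of_nonneg (by positivity)]
    calc (1 : ℝ) < 2 ^ (N + shell ξ) := one_lt_zpow₀ one_lt_two (by omega)
      _ = 2 ^ N * 2 ^ shell ξ := zpow_add₀ (by norm_num) _ _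
      _ ≤ _ := by gcongr
  have hχ : P.χ ((2 : ℝ) ^ N • (2 * Real.pi) • ξ) = 0 := by
    by_contra hne
    exact absurd (P.χ_support _ hne) (not_le.2 hy)
  have hsum := P.sum_eq ((2 : ℝ) ^ N • (2 * Real.pi) • ξ)
  rw [hχ, sub_zero] at hsum
  have hinj : Function.Injective fun q : ℕ => (q : ℤ) - N := fun a b hab => by
    simpa using hab
  rw [← hinj.hasSum_iff]
  · convert hsum using 2 with q
    simp only [Function.comp, DyadicPartition.symbol]
    rw [smul_smul ((2 : ℝ) ^ (-(q : ℤ))), ← zpow_add₀ (by norm_num)]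
    ring_nf
  · intro q hq
    by_contra hne
    have := Finset.mem_Icc.1 (mem_of_mem_ring (P.mem_ring_of_symbol_ne_zero hne))
    refine hq ⟨(q + N).toNat, ?_⟩
    have : 0 ≤ q + N := by omega
    simp [Int.toNat_of_nonneg this]

theorem DyadicPartition.sum_symbol (P : DyadicPartition d) {ξ : Sp d} (h : ξ ≠ 0) {I : Finset ℤ}
    (hI : Finset.Icc (shell ξ - 1) (shell ξ + 1) ⊆ I) : ∑ q ∈ I, P.symbol q ξ = 1 := by
  refine (hasSum_sum_of_ne_finset_zero fun q hq => ?_).unique (P.hasSum_symbol h)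
  by_contra hne
  exact hq (hI (mem_of_mem_ring (P.mem_ring_of_symbol_ne_zero hne)))

/-- The constant 4π is sharp for the second bound and crude for the first; one constant is used for
both. -/
theorem norm_comparable_of_mem_ring {q : ℤ} {ξ : Sp d} (h : ξ ∈ dyadicRing d q) :
    ‖ξ‖ ≤ 4 * Real.pi * 2 ^ q ∧ (2 : ℝ) ^ q ≤ 4 * Real.pi * ‖ξ‖ := by
  obtain ⟨h1, h2⟩ := h
  have hpi := Real.pi_gt_three
  have hq : (0 : ℝ) < 2 ^ q := by positivity
  rw [zpow_sub₀ (by norm_num), zpow_one] at h1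
  rw [zpow_add₀ (by norm_num), zpow_one] at h2
  constructor
  · nlinarith [norm_nonneg ξ]
  · linarith

theorem weight_le_of_mem_ring {q : ℤ} {ξ : Sp d} (h : ξ ∈ dyadicRing d q) (p : ℝ) :
    weight p ξ ≤ ENNReal.ofReal ((4 * Real.pi) ^ |p|) * ENNReal.ofReal (2 ^ (q * p)) := by
  obtain ⟨h1, h2⟩ := norm_comparable_of_mem_ring h
  rw [weight, ← ENNReal.ofReal_mul (by positivity), Real.rpow_mul (by norm_num), Real.rpow_intCast]
  exact ENNReal.ofReal_le_ofReal (rpow_le_rpow_of_comparable p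
    (norm_pos_iff.2 (ne_zero_of_mem_ring h)) (by positivity) (by linarith [Real.pi_gt_three]) h1 h2)

theorem le_weight_of_mem_ring {q : ℤ} {ξ : Sp d} (h : ξ ∈ dyadicRing d q) (p : ℝ) :
    ENNReal.ofReal (2 ^ (q * p)) ≤ ENNReal.ofReal ((4 * Real.pi) ^ |p|) * weight p ξ := by
  obtain ⟨h1, h2⟩ := norm_comparable_of_mem_ring h
  rw [weight, ← ENNReal.ofReal_mul (by positivity), Real.rpow_mul (by norm_num), Real.rpow_intCast]
  exact ENNReal.ofReal_le_ofReal (rpow_le_rpow_of_comparable p (by positivity)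
    (norm_pos_iff.2 (ne_zero_of_mem_ring h)) (by linarith [Real.pi_gt_three]) h2 h1)

/-! ### Dyadic blocks on the Fourier side -/

/-- The infimum is attained because the embedding of L^p in the tempered distributions is injective:
there is only one competitor. -/
theorem exists_lp_of_distLpNorm_ne_top {p : ℝ≥0∞} [Fact (1 ≤ p)] {u : 𝓢'(Sp d, ℂ)}
    (h : distLpNorm p u ≠ ⊤) : ∃ f : Lp ℂ p (volume : Measure (Sp d)),
      Lp.toTemperedDistribution f = u ∧ ‖f‖ₑ = distLpNorm p u := by
  obtain ⟨f, hf⟩ : ∃ f : Lp ℂ p (volume : Measure (Sp d)), Lp.toTemperedDistribution f = u := by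
    by_contra! hne
    exact h (by simp [distLpNorm, hne])
  refine ⟨f, hf, le_antisymm (le_iInf₂ fun g hg => le_of_eq ?_) (iInf₂_le f hf)⟩
  have inj : Function.Injective (Lp.toTemperedDistributionCLM ℂ (volume : Measure (Sp d)) p) :=
    LinearMap.ker_eq_bot.1 Lp.ker_toTemperedDistributionCLM_eq_bot
  rw [inj (a₁ := f) (a₂ := g) (hf.trans hg.symm)]

theorem enorm_apply_le_of_distLpNorm_top {T : 𝓢'(Sp d, ℂ)} (h : distLpNorm ⊤ T ≠ ⊤)
    (v : 𝓢(Sp d, ℂ)) : ‖T v‖ₑ ≤ distLpNorm ⊤ T * ∫⁻ x, ‖v x‖ₑ := by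
  obtain ⟨f, hf, hn⟩ := exists_lp_of_distLpNorm_ne_top h
  rw [← hn, ← hf, Lp.toTemperedDistribution_apply, ← lintegral_const_mul _ (by fun_prop)]
  refine (enorm_integral_le_lintegral_enorm _).trans (lintegral_mono_ae ?_)
  filter_upwards [enorm_ae_le_eLpNormEssSup f volume] with x hx
  rw [smul_eq_mul, enorm_mul, mul_comm]
  gcongr
  rwa [Lp.enorm_def, eLpNorm_exponent_top]

theorem enorm_lp_two_sq (h : Lp ℂ 2 (volume : Measure (Sp d))) :
    ‖h‖ₑ ^ 2 = ∫⁻ ξ, ‖h ξ‖ₑ ^ 2 := by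
  have := eLpNorm_nnreal_pow_eq_lintegral (μ := (volume : Measure (Sp d))) (f := h) (p := 2)
    (by norm_num)
  rw [Lp.enorm_def]
  simpa using this

theorem integrable_schwartz_mul_lp (v : 𝓢(Sp d, ℂ)) (h : Lp ℂ 2 (volume : Measure (Sp d))) :
    Integrable fun ξ => v ξ * h ξ :=
  (v.memLp 2).integrable_mul (Lp.memLp h)

/-- By Plancherel: h is the Fourier transform of the L² function representing the block. -/
theorem DyadicPartition.exists_fourier_block (P : DyadicPartition d) {q : ℤ} {u : 𝓢'(Sp d, ℂ)}
    (hq : distLpNorm 2 (P.block q u) ≠ ⊤) : ∃ h : Lp ℂ 2 (volume : Measure (Sp d)),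
      ‖h‖ₑ = distLpNorm 2 (P.block q u) ∧ ∀ v : 𝓢(Sp d, ℂ),
        𝓕 u (SchwartzMap.smulLeftCLM ℂ (fun ξ => (P.symbol q ξ : ℂ)) v) = ∫ ξ, v ξ * h ξ := by
  obtain ⟨g, hg, hn⟩ := exists_lp_of_distLpNorm_ne_top hq
  refine ⟨𝓕 g, ?_, fun v => ?_⟩
  · rw [← hn, ← ofReal_norm, Lp.norm_fourier_eq, ofReal_norm]
  · have := congrArg (fun T : 𝓢'(Sp d, ℂ) => (𝓕 T : 𝓢'(Sp d, ℂ)) v) hg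
    simp only [Lp.fourier_toTemperedDistribution_eq, Lp.toTemperedDistribution_apply] at this
    rw [DyadicPartition.block, TemperedDistribution.fourierMultiplierCLM_apply,
      FourierTransform.fourier_fourierInv_eq, TemperedDistribution.smulLeftCLM_apply_apply] at this
    exact this.symm

/-- A test function supported off the ring is annihilated by the symbol, so h integrates to zero
against it. -/
theorem DyadicPartition.ae_fourier_block_eq_zero (P : DyadicPartition d) {q : ℤ}
    {u : 𝓢'(Sp d, ℂ)} {h : Lp ℂ 2 (volume : Measure (Sp d))} (hh : ∀ v : 𝓢(Sp d, ℂ),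
      𝓕 u (SchwartzMap.smulLeftCLM ℂ (fun ξ => (P.symbol q ξ : ℂ)) v) = ∫ ξ, v ξ * h ξ) :
    ∀ᵐ ξ, h ξ ≠ 0 → ξ ∈ dyadicRing d q := by
  have := (isClosed_ring (d := d) q).isOpen_compl.ae_eq_zero_of_integral_contDiff_smul_eq_zero
    (f := h) (μ := volume) (((Lp.memLp h).locallyIntegrable one_le_two).locallyIntegrableOn _) ?_
  · filter_upwards [this] with ξ hξ
    contrapose!
    exact hξ
  · intro g hg hc hU
    have hc' : HasCompactSupport fun x => (g x : ℂ) := hc.comp_left (g := Complex.ofReal) (by simp)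
    set w := hc'.toSchwartzMap (Complex.ofRealCLM.contDiff.comp hg)
    have hw : ∀ ξ, w ξ = g ξ := fun _ => rfl
    have e := hh w
    have z : SchwartzMap.smulLeftCLM ℂ (fun ξ => (P.symbol q ξ : ℂ)) w = 0 := by
      ext ξ
      rw [SchwartzMap.smulLeftCLM_apply_apply (P.symbol_hasTemperateGrowth q), hw]
      by_cases hs : P.symbol q ξ = 0
      · simp [hs]
      · have : g ξ = 0 := by
          by_contra hne
          exact hU (subset_tsupport _ hne) (P.mem_ring_of_symbol_ne_zero hs)
        simp [this]
    rw [z, map_zero] at e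
    simpa [hw] using e.symm

/-! ### Gluing the blocks into one density -/

/-- The sum at `ξ` of those `h q` whose dyadic ring can contain `ξ`. -/
def glue (h : ℤ → Sp d → ℂ) (ξ : Sp d) : ℂ :=
  h (shell ξ - 1) ξ + h (shell ξ) ξ + h (shell ξ + 1) ξ

theorem Icc_shell (n : ℤ) : Finset.Icc (n - 1) (n + 1) = {n - 1, n, n + 1} := by
  ext m
  simp only [Finset.mem_Icc, Finset.mem_insert, Finset.mem_singleton]
  omega

theorem sum_Icc_shell {M : Type*} [AddCommMonoid M] (n : ℤ) (g : ℤ → M) :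
    ∑ q ∈ Finset.Icc (n - 1) (n + 1), g q = g (n - 1) + g n + g (n + 1) := by
  rw [Icc_shell, Finset.sum_insert (by simp; omega), Finset.sum_insert (by simp),
    Finset.sum_singleton, add_assoc]

theorem measurable_glue {h : ℤ → Sp d → ℂ} (hm : ∀ q, Measurable (h q)) : Measurable (glue h) := by
  have key : Measurable fun x : Sp d × ℤ => h x.2 x.1 := measurable_from_prod_countable_left hm
  have k : ∀ j : ℤ, Measurable fun ξ : Sp d => h (shell ξ + j) ξ := fun j =>
    key.comp (measurable_id.prodMk (measurable_shell.add_const j))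
  have k0 := k 0
  have k1 := k (-1)
  simp only [add_zero, ← sub_eq_add_neg] at k0 k1
  exact (k1.add k0).add (k 1)

theorem glue_eq_sum {h : ℤ → Sp d → ℂ} {ξ : Sp d} (hs : ∀ q, h q ξ ≠ 0 → ξ ∈ dyadicRing d q)
    {I : Finset ℤ} (hI : Finset.Icc (shell ξ - 1) (shell ξ + 1) ⊆ I) :
    glue h ξ = ∑ q ∈ I, h q ξ := by
  rw [glue, ← sum_Icc_shell (shell ξ) (fun q => h q ξ)]
  refine Finset.sum_subset hI fun q _ hq => ?_
  by_contra hne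
  exact hq (mem_of_mem_ring (hs q hne))

/-- At each frequency at most three terms are nonzero, and on the ring of index q the weight
|ξ|^(2s) is comparable to 2^(2qs). -/
theorem weightedNormSq_glue_le {h : ℤ → Sp d → ℂ} (hm : ∀ q, Measurable (h q))
    (hs : ∀ᵐ ξ, ∀ q, h q ξ ≠ 0 → ξ ∈ dyadicRing d q) (s : ℝ) :
    weightedNormSq s (fun ξ => ‖glue h ξ‖ₑ) ≤ 3 * ENNReal.ofReal ((4 * Real.pi) ^ |2 * s|) *
      ∑' q : ℤ, ENNReal.ofReal ((2 : ℝ) ^ (2 * (q : ℝ) * s)) * ∫⁻ ξ, ‖h q ξ‖ₑ ^ 2 := by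
  have e : ∀ q : ℤ, ENNReal.ofReal ((2 : ℝ) ^ (2 * (q : ℝ) * s)) * ∫⁻ ξ, ‖h q ξ‖ₑ ^ 2 =
      ∫⁻ ξ, ENNReal.ofReal ((2 : ℝ) ^ (2 * (q : ℝ) * s)) * ‖h q ξ‖ₑ ^ 2 := fun q =>
    (lintegral_const_mul _ (by have := hm q; fun_prop)).symm
  simp_rw [e]
  rw [← lintegral_tsum (fun q => by have := hm q; fun_prop), ← lintegral_const_mul']
  swap
  · finiteness
  refine lintegral_mono_ae ?_
  filter_upwards [hs] with ξ hξ
  have hq : ∀ q, weight (2 * s) ξ * ‖h q ξ‖ₑ ^ 2 ≤ ENNReal.ofReal ((4 * Real.pi) ^ |2 * s|) *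
      (ENNReal.ofReal ((2 : ℝ) ^ (2 * (q : ℝ) * s)) * ‖h q ξ‖ₑ ^ 2) := by
    intro q
    by_cases h0 : h q ξ = 0
    · simp [h0]
    · rw [← mul_assoc]
      gcongr
      rw [show 2 * (q : ℝ) * s = q * (2 * s) by ring]
      exact weight_le_of_mem_ring (hξ q h0) (2 * s)
  calc weight (2 * s) ξ * ‖glue h ξ‖ₑ ^ 2
      ≤ weight (2 * s) ξ * (3 * (‖h (shell ξ - 1) ξ‖ₑ ^ 2 + ‖h (shell ξ) ξ‖ₑ ^ 2 +
          ‖h (shell ξ + 1) ξ‖ₑ ^ 2)) := by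
        gcongr
        refine le_trans ?_ (add_add_sq_le _ _ _)
        gcongr
        exact (enorm_add_le _ _).trans (by gcongr; exact enorm_add_le _ _)
    _ = 3 * ∑ q ∈ Finset.Icc (shell ξ - 1) (shell ξ + 1), weight (2 * s) ξ * ‖h q ξ‖ₑ ^ 2 := by
        rw [← Finset.mul_sum, sum_Icc_shell (shell ξ) (fun q => ‖h q ξ‖ₑ ^ 2)]
        ring
    _ ≤ 3 * ∑ q ∈ Finset.Icc (shell ξ - 1) (shell ξ + 1),
          ENNReal.ofReal ((4 * Real.pi) ^ |2 * s|) *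
          (ENNReal.ofReal ((2 : ℝ) ^ (2 * (q : ℝ) * s)) * ‖h q ξ‖ₑ ^ 2) := by
        gcongr 3 * ?_
        exact Finset.sum_le_sum fun q _ => hq q
    _ ≤ _ := by
        rw [← Finset.mul_sum, ← mul_assoc]
        gcongr
        exact ENNReal.sum_le_tsum _

theorem DyadicPartition.sobolevNorm_sq (P : DyadicPartition d) (s : ℝ) (u : 𝓢'(Sp d, ℂ)) :
    P.sobolevNorm s u ^ 2 =
      ∑' q : ℤ, ENNReal.ofReal ((2 : ℝ) ^ (2 * (q : ℝ) * s)) * distLpNorm 2 (P.block q u) ^ 2 := by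
  rw [DyadicPartition.sobolevNorm, ← ENNReal.rpow_mul_natCast]
  norm_num

theorem DyadicPartition.distLpNorm_block_ne_top (P : DyadicPartition d) {s : ℝ}
    {u : 𝓢'(Sp d, ℂ)} (h : P.sobolevNorm s u < ⊤) (q : ℤ) : distLpNorm 2 (P.block q u) ≠ ⊤ := by
  have h1 : P.sobolevNorm s u ^ 2 ≠ ⊤ := by finiteness
  rw [P.sobolevNorm_sq] at h1
  have h2 := ENNReal.ne_top_of_tsum_ne_top h1 q
  intro h3
  rw [h3] at h2
  refine h2 ?_
  rw [ENNReal.top_pow (by norm_num), ENNReal.mul_top]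
  exact (ENNReal.ofReal_pos.2 (by positivity)).ne'

/-- On the annulus carrying v finitely many symbols already sum to 1, so v is a finite sum of
localized pieces. This determines the Fourier transform of u only away from the origin. -/
theorem DyadicPartition.fourier_apply_eq_integral_glue (P : DyadicPartition d) [NeZero d]
    {u : 𝓢'(Sp d, ℂ)} {h : ℤ → Lp ℂ 2 (volume : Measure (Sp d))}
    (hh : ∀ q, ∀ v : 𝓢(Sp d, ℂ),
      𝓕 u (SchwartzMap.smulLeftCLM ℂ (fun ξ => (P.symbol q ξ : ℂ)) v) = ∫ ξ, v ξ * h q ξ)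
    {v : 𝓢(Sp d, ℂ)} {a b : ℝ} (ha : 0 < a) (hv : ∀ ξ, v ξ ≠ 0 → a ≤ ‖ξ‖ ∧ ‖ξ‖ ≤ b) :
    𝓕 u v = ∫ ξ, v ξ * glue (fun q => h q) ξ := by
  set I : Finset ℤ := Finset.Icc (⌊Real.logb 2 (2 * Real.pi * a)⌋ - 1)
    (⌊Real.logb 2 (2 * Real.pi * b)⌋ + 1)
  have hI : ∀ ξ, v ξ ≠ 0 → ξ ≠ 0 ∧ Finset.Icc (shell ξ - 1) (shell ξ + 1) ⊆ I := by
    intro ξ hξ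
    obtain ⟨h1, h2⟩ := hv ξ hξ
    have hp : 0 < ‖ξ‖ := ha.trans_le h1
    refine ⟨norm_pos_iff.1 hp, Finset.Icc_subset_Icc ?_ ?_⟩
    · have : ⌊Real.logb 2 (2 * Real.pi * a)⌋ ≤ shell ξ :=
        Int.floor_mono (Real.logb_le_logb_of_le one_lt_two (by positivity) (by gcongr))
      omega
    · have : shell ξ ≤ ⌊Real.logb 2 (2 * Real.pi * b)⌋ :=
        Int.floor_mono (Real.logb_le_logb_of_le one_lt_two (by positivity) (by gcongr))
      omega
  have hsum : v = ∑ q ∈ I, SchwartzMap.smulLeftCLM ℂ (fun ξ => (P.symbol q ξ : ℂ)) v := by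
    ext ξ
    rw [sum_apply]
    simp only [SchwartzMap.smulLeftCLM_apply_apply (P.symbol_hasTemperateGrowth _), smul_eq_mul]
    rw [← Finset.sum_mul]
    by_cases h0 : v ξ = 0
    · simp [h0]
    · rw [← Complex.ofReal_sum, P.sum_symbol (hI ξ h0).1 (hI ξ h0).2]
      simp
  have hae : ∀ᵐ ξ, ∀ q, h q ξ ≠ 0 → ξ ∈ dyadicRing d q :=
    ae_all_iff.2 fun q => P.ae_fourier_block_eq_zero (hh q)
  conv_lhs => rw [hsum]
  rw [map_sum]
  simp_rw [hh]
  rw [← integral_finsetSum _ fun q _ => integrable_schwartz_mul_lp v (h q)]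
  refine integral_congr_ae ?_
  filter_upwards [hae] with ξ hξ
  rw [← Finset.mul_sum]
  by_cases h0 : v ξ = 0
  · simp [h0]
  · rw [glue_eq_sum hξ (hI ξ h0).2]

/-! ### No mass at the origin: the density of an element of Ḣ^s -/

/-- The pairing is that of θ(lD)u with the integrable function 𝓕 w, so the L^∞ decay suffices. This
is how homogeneity excludes a part of 𝓕 u carried by the origin. -/
theorem tendsto_fourier_cutoff_smul {u : 𝓢'(Sp d, ℂ)} (hu : IsHomogeneous u) {θ : Sp d → ℂ}
    (h1 : ContDiff ℝ ∞ θ) (h2 : HasCompactSupport θ) (w : 𝓢(Sp d, ℂ)) :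
    Tendsto (fun l : ℝ => 𝓕 u (SchwartzMap.smulLeftCLM ℂ (fun ξ => θ (l • ξ)) w)) atTop (𝓝 0) := by
  have hl := hu θ h1 h2
  rw [tendsto_zero_iff_enorm_tendsto_zero]
  have hfin : ∫⁻ x, ‖(𝓕 w) x‖ₑ ≠ ⊤ := (𝓕 w).integrable.hasFiniteIntegral.ne
  have h0 := ENNReal.Tendsto.mul_const hl (Or.inr hfin)
  rw [zero_mul] at h0
  refine tendsto_of_tendsto_of_tendsto_of_le_of_le' tendsto_const_nhds h0
    (.of_forall fun _ => zero_le) ?_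
  filter_upwards [hl.eventually (gt_mem_nhds ENNReal.zero_lt_top)] with l hl
  have := enorm_apply_le_of_distLpNorm_top hl.ne (𝓕 w)
  rwa [TemperedDistribution.fourierMultiplierCLM_apply_apply,
    FourierTransform.fourierInv_fourier_eq, ← TemperedDistribution.fourier_apply] at this

/-- The supports shrink to the origin, a null set because d > 0; for l ≥ 1 they stay in one ball,
where g is integrable. -/
theorem tendsto_lintegral_dilate_cutoff_atTop [NeZero d] {θ : Sp d → ℂ} (h1 : Continuous θ)
    (h2 : HasCompactSupport θ) {g : Sp d → ℂ} (hg : Measurable g)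
    (hi : ∀ R : ℝ, IntegrableOn g (Metric.closedBall 0 R)) :
    Tendsto (fun l : ℝ => ∫⁻ ξ, ‖θ (l • ξ) * g ξ‖ₑ) atTop (𝓝 0) := by
  obtain ⟨K, hK⟩ := h2.exists_bound_of_continuous h1
  obtain ⟨R, hR0, hR⟩ := h2.isCompact.isBounded.exists_pos_norm_le
  have hz : ∀ ξ, R < ‖ξ‖ → θ ξ = 0 := fun ξ h => by
    by_contra hne
    exact absurd (hR ξ (subset_tsupport _ hne)) (not_le.2 h)
  rw [← lintegral_zero (μ := (volume : Measure (Sp d)))]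
  refine tendsto_lintegral_filter_of_dominated_convergence
    ((Metric.closedBall 0 R).indicator fun ξ => ENNReal.ofReal K * ‖g ξ‖ₑ) ?_ ?_ ?_ ?_
  · exact .of_forall fun l => ((h1.measurable.comp (measurable_const_smul l)).mul hg).enorm
  · filter_upwards [eventually_ge_atTop 1] with l hl
    refine .of_forall fun ξ => ?_
    by_cases h : ξ ∈ Metric.closedBall 0 R
    · rw [Set.indicator_of_mem h, enorm_mul]
      gcongr
      rw [← ofReal_norm]
      exact ENNReal.ofReal_le_ofReal (hK _)
    · have : R < ‖l • ξ‖ := by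
        have h3 : R < ‖ξ‖ := by simpa using h
        rw [norm_smul, Real.norm_of_nonneg (by linarith)]
        nlinarith [norm_nonneg ξ]
      simp [hz _ this]
  · rw [lintegral_indicator Metric.isClosed_closedBall.measurableSet,
      lintegral_const_mul _ (by fun_prop)]
    exact ENNReal.mul_ne_top (by simp) (hi R).hasFiniteIntegral.ne
  · filter_upwards [ae_ne_zero] with ξ hξ
    refine tendsto_const_nhds.congr' ?_
    have ht : Tendsto (fun l : ℝ => l * ‖ξ‖) atTop atTop :=
      tendsto_id.atTop_mul_const (norm_pos_iff.2 hξ)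
    filter_upwards [ht.eventually_gt_atTop R, eventually_ge_atTop 0] with l hl hl0
    rw [hz]
    · simp
    · rwa [norm_smul, Real.norm_of_nonneg hl0]

theorem tendsto_dilate_cutoff_nhds {θ : Sp d → ℂ} (h3 : ∀ᶠ ξ in 𝓝 0, θ ξ = 1) (ξ : Sp d) :
    ∀ᶠ ε : ℝ in 𝓝[>] 0, θ (ε • ξ) = 1 := by
  have h0 : Tendsto (fun ε : ℝ => ε • ξ) (𝓝[>] 0) (𝓝 0) := by
    have : Tendsto (fun ε : ℝ => ε • ξ) (𝓝 0) (𝓝 ((0 : ℝ) • ξ)) :=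
      Continuous.tendsto (by fun_prop) 0
    rw [zero_smul] at this
    exact this.mono_left nhdsWithin_le_nhds
  exact h0.eventually h3

theorem tendsto_integral_dilate_cutoff_nhds {θ : Sp d → ℂ} (h1 : Continuous θ)
    (h2 : HasCompactSupport θ) (h3 : ∀ᶠ ξ in 𝓝 0, θ ξ = 1) {g : Sp d → ℂ} (hg : Integrable g) :
    Tendsto (fun ε : ℝ => ∫ ξ, θ (ε • ξ) * g ξ) (𝓝[>] 0) (𝓝 (∫ ξ, g ξ)) := by
  obtain ⟨K, hK⟩ := h2.exists_bound_of_continuous h1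
  refine tendsto_integral_filter_of_dominated_convergence (fun ξ => K * ‖g ξ‖) ?_ ?_
    (hg.norm.const_mul K) ?_
  · exact .of_forall fun ε => (Continuous.aestronglyMeasurable (by fun_prop)).mul hg.1
  · refine .of_forall fun ε => .of_forall fun ξ => ?_
    rw [norm_mul]
    gcongr
    exact hK _
  · refine .of_forall fun ξ => tendsto_const_nhds.congr' ?_
    filter_upwards [tendsto_dilate_cutoff_nhds h3 ξ] with ε h
    rw [h, one_mul]

/-- The Fourier transform of an element of `Ḣ^s`, `|s| < d/2`, is a function. -/
theorem DyadicPartition.MemSobolev.exists_density [NeZero d] {P : DyadicPartition d} {s : ℝ}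
    (hs : |s| < (d : ℝ) / 2) {u : 𝓢'(Sp d, ℂ)} (hu : P.MemSobolev s u) :
    ∃ f : Sp d → ℂ, HasFourierDensity u f ∧ weightedNormSq s (fun ξ => ‖f ξ‖ₑ) ≤
      3 * ENNReal.ofReal ((4 * Real.pi) ^ |2 * s|) * P.sobolevNorm s u ^ 2 := by
  choose h hn hh using fun q => P.exists_fourier_block (P.distLpNorm_block_ne_top hu.2 q)
  have hm : ∀ q, Measurable (h q) := fun q => (Lp.stronglyMeasurable (h q)).measurable
  have hbound := weightedNormSq_glue_le hm
    (ae_all_iff.2 fun q => P.ae_fourier_block_eq_zero (hh q)) s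
  simp_rw [← enorm_lp_two_sq, hn, ← P.sobolevNorm_sq] at hbound
  set f := glue fun q => (h q : Sp d → ℂ) with hf
  have hfm : Measurable f := measurable_glue hm
  have hW : weightedNormSq s (fun ξ => ‖f ξ‖ₑ) ≠ ⊤ := by
    refine (hbound.trans_lt ?_).ne
    have := hu.2
    finiteness
  have hint := integrable_schwartz_mul (integrable_decay_mul hs hfm hW)
  refine ⟨f, ⟨hfm, hint, fun v => ?_⟩, hbound⟩
  let B : ContDiffBump (0 : Sp d) := ⟨1, 2, one_pos, one_lt_two⟩
  set θ : Sp d → ℂ := fun ξ => (B ξ : ℂ) with hθ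
  have h1 : ContDiff ℝ ∞ θ := Complex.ofRealCLM.contDiff.comp B.contDiff
  have h2 : HasCompactSupport θ := B.hasCompactSupport.comp_left (g := Complex.ofReal) (by simp)
  have hone : ∀ ξ : Sp d, ‖ξ‖ ≤ 1 → θ ξ = 1 := fun ξ hξ => by
    rw [hθ]
    simp only
    rw [B.one_of_mem_closedBall (by simpa [B] using hξ), Complex.ofReal_one]
  have hzero : ∀ ξ : Sp d, θ ξ ≠ 0 → ‖ξ‖ ≤ 2 := fun ξ hξ => by
    by_contra! hlt
    refine hξ ?_
    rw [hθ]
    simp only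
    rw [B.zero_of_le_dist (by simpa [B] using hlt.le), Complex.ofReal_zero]
  have h3 : ∀ᶠ ξ in 𝓝 0, θ ξ = 1 := by
    filter_upwards [Metric.closedBall_mem_nhds (0 : Sp d) one_pos] with ξ hξ
    exact hone ξ (by simpa using hξ)
  -- Compactly supported test functions come first, so that cutting off the origin leaves a function
  -- carried by an annulus.
  have hcompact : ∀ ε : ℝ, 0 < ε → 𝓕 u (SchwartzMap.smulLeftCLM ℂ (fun ξ => θ (ε • ξ)) v) =
      ∫ ξ, SchwartzMap.smulLeftCLM ℂ (fun ξ => θ (ε • ξ)) v ξ * f ξ := by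
    intro ε hε
    set w := SchwartzMap.smulLeftCLM ℂ (fun ξ => θ (ε • ξ)) v with hw
    have hws : ∀ ξ, w ξ ≠ 0 → ‖ξ‖ ≤ 2 / ε := by
      intro ξ hξ
      rw [hw, SchwartzMap.smulLeftCLM_apply_apply (cutoff_scale h1 h2 ε)] at hξ
      have := hzero _ (left_ne_zero_of_mul hξ)
      rw [norm_smul, Real.norm_of_nonneg hε.le] at this
      rwa [le_div_iff₀' hε]
    -- The difference between 𝓕 u and the density f is the same on w as on θ(l ·) w, since w - θ(l
    -- ·) w vanishes near the origin. As l → ∞ both terms on the right tend to zero.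
    have hsplit : ∀ l : ℝ, 0 < l → 𝓕 u w - ∫ ξ, w ξ * f ξ =
        𝓕 u (SchwartzMap.smulLeftCLM ℂ (fun ξ => θ (l • ξ)) w) - ∫ ξ, θ (l • ξ) * (w ξ * f ξ) := by
      intro l hl
      set w' := SchwartzMap.smulLeftCLM ℂ (fun ξ => θ (l • ξ)) w with hw'
      have e' : ∀ ξ, w' ξ = θ (l • ξ) * w ξ := fun ξ => by
        rw [hw', SchwartzMap.smulLeftCLM_apply_apply (cutoff_scale h1 h2 l), smul_eq_mul]
      have key : 𝓕 u (w - w') = ∫ ξ, (w - w') ξ * f ξ := by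
        refine P.fourier_apply_eq_integral_glue hh (a := 1 / l) (b := 2 / ε) (by positivity) ?_
        intro ξ hξ
        rw [sub_apply, e', ← one_sub_mul] at hξ
        refine ⟨?_, hws ξ (right_ne_zero_of_mul hξ)⟩
        by_contra! hlt
        refine left_ne_zero_of_mul hξ ?_
        rw [hone, sub_self]
        rw [norm_smul, Real.norm_of_nonneg hl.le]
        rw [lt_div_iff₀' hl] at hlt
        exact hlt.le
      have e2 : ∫ ξ, (w - w') ξ * f ξ = (∫ ξ, w ξ * f ξ) - ∫ ξ, θ (l • ξ) * (w ξ * f ξ) := by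
        have := integral_sub (hint w) (hint w')
        simp only [e', mul_assoc] at this
        rw [← this]
        refine integral_congr_ae (.of_forall fun ξ => ?_)
        simp only [sub_apply, e']
        ring
      rw [map_sub, e2] at key
      linear_combination key
    have ht : Tendsto (fun l : ℝ => 𝓕 u (SchwartzMap.smulLeftCLM ℂ (fun ξ => θ (l • ξ)) w) -
        ∫ ξ, θ (l • ξ) * (w ξ * f ξ)) atTop (𝓝 (0 - 0)) := by
      refine (tendsto_fourier_cutoff_smul hu.1 h1 h2 w).sub ?_
      rw [tendsto_zero_iff_enorm_tendsto_zero]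
      exact tendsto_of_tendsto_of_tendsto_of_le_of_le tendsto_const_nhds
        (tendsto_lintegral_dilate_cutoff_atTop h1.continuous h2 (g := fun ξ => w ξ * f ξ)
          (by fun_prop) fun R => (hint w).integrableOn)
        (fun _ => zero_le) fun l => enorm_integral_le_lintegral_enorm _
    have hc : Tendsto (fun _ : ℝ => 𝓕 u w - ∫ ξ, w ξ * f ξ) atTop (𝓝 (0 - 0)) := by
      refine ht.congr' ?_
      filter_upwards [eventually_gt_atTop 0] with l hl
      exact (hsplit l hl).symm
    rw [sub_zero] at hc
    exact sub_eq_zero.1 (tendsto_nhds_unique tendsto_const_nhds hc)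
  have t1 := ((𝓕 u).continuous.tendsto v).comp (tendsto_cutoff_smul h1 h2 (hone 0 (by simp)) v)
  have t2 := tendsto_integral_dilate_cutoff_nhds h1.continuous h2 h3 (hint v)
  refine tendsto_nhds_unique (t1.congr' ?_) t2
  filter_upwards [self_mem_nhdsWithin] with ε hε
  refine (hcompact ε hε).trans (integral_congr_ae (.of_forall fun ξ => ?_))
  simp only [SchwartzMap.smulLeftCLM_apply_apply (cutoff_scale h1 h2 ε), smul_eq_mul, mul_assoc]

/-! ### From a density back to homogeneity and Sobolev norms -/

theorem HasFourierDensity.integrable_mul {u : 𝓢'(Sp d, ℂ)} {f : Sp d → ℂ}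
    (h : HasFourierDensity u f) {m : Sp d → ℂ} (h1 : ContDiff ℝ ∞ m) (h2 : HasCompactSupport m) :
    Integrable fun ξ => m ξ * f ξ :=
  h.integrable (h2.toSchwartzMap h1)

theorem HasFourierDensity.integrable_cutoff_mul {u : 𝓢'(Sp d, ℂ)} {f : Sp d → ℂ}
    (h : HasFourierDensity u f) {θ : Sp d → ℂ} (h1 : ContDiff ℝ ∞ θ) (h2 : HasCompactSupport θ)
    {ε : ℝ} (hε : 0 < ε) : Integrable fun ξ => θ (ε • ξ) * f ξ :=
  h.integrable_mul (h1.comp (by fun_prop)) (h2.comp_smul hε.ne')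

theorem HasFourierDensity.integrableOn_closedBall {u : 𝓢'(Sp d, ℂ)} {f : Sp d → ℂ}
    (h : HasFourierDensity u f) (R : ℝ) : IntegrableOn f (Metric.closedBall 0 R) := by
  let B : ContDiffBump (0 : Sp d) := ⟨max R 1, max R 1 + 1, by positivity, by linarith⟩
  have h2 : HasCompactSupport fun ξ => (B ξ : ℂ) :=
    B.hasCompactSupport.comp_left (g := Complex.ofReal) (by simp)
  refine (h.integrable_mul (Complex.ofRealCLM.contDiff.comp B.contDiff) h2).integrableOn.congr_fun
    (fun ξ hξ => ?_) Metric.isClosed_closedBall.measurableSet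
  have : B ξ = 1 := B.one_of_mem_closedBall (Metric.closedBall_subset_closedBall (le_max_left _ _) hξ)
  simp [this]

theorem integral_fourierInv_mul_eq {v g : Sp d → ℂ} (hv : Integrable v) (hg : Integrable g) :
    ∫ ξ, 𝓕⁻ v ξ * g ξ = ∫ x, v x * 𝓕⁻ g x := by
  have hL : Continuous fun p : Sp d × Sp d => (-innerₗ (Sp d)) p.1 p.2 := by
    simp only [LinearMap.neg_apply, innerₗ_apply_apply]
    fun_prop
  have := VectorFourier.integral_fourierIntegral_smul_eq_flip (L := -innerₗ (Sp d))
    Real.continuous_fourierChar hL hv hg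
  have e : (-innerₗ (Sp d)).flip = -innerₗ (Sp d) := by
    ext x y
    simp [real_inner_comm]
  rw [e] at this
  exact this

theorem HasFourierDensity.apply_eq_integral {u : 𝓢'(Sp d, ℂ)} {g : Sp d → ℂ}
    (h : HasFourierDensity u g) (hg : Integrable g) (v : 𝓢(Sp d, ℂ)) :
    u v = ∫ x, v x * 𝓕⁻ g x := by
  rw [h.apply, SchwartzMap.fourierInv_coe, integral_fourierInv_mul_eq v.integrable hg]

theorem norm_fourierInv_le (g : Sp d → ℂ) (x : Sp d) : ‖𝓕⁻ g x‖ ≤ ∫ ξ, ‖g ξ‖ :=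
  VectorFourier.norm_fourierIntegral_le_integral_norm _ _ _ _ _

theorem continuous_fourierInv {g : Sp d → ℂ} (hg : Integrable g) : Continuous (𝓕⁻ g) := by
  refine VectorFourier.fourierIntegral_continuous (L := -innerₗ (Sp d))
    Real.continuous_fourierChar ?_ hg
  simp only [LinearMap.neg_apply, innerₗ_apply_apply]
  fun_prop

theorem distLpNorm_le {p : ℝ≥0∞} [Fact (1 ≤ p)] {u : 𝓢'(Sp d, ℂ)}
    {f : Lp ℂ p (volume : Measure (Sp d))} (h : Lp.toTemperedDistribution f = u) :
    distLpNorm p u ≤ ‖f‖ₑ := iInf₂_le f h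

theorem HasFourierDensity.distLpNorm_top_le {u : 𝓢'(Sp d, ℂ)} {g : Sp d → ℂ}
    (h : HasFourierDensity u g) (hg : Integrable g) : distLpNorm ⊤ u ≤ ∫⁻ ξ, ‖g ξ‖ₑ := by
  have hM : MemLp (𝓕⁻ g) ⊤ := memLp_top_of_bound
    (continuous_fourierInv hg).aestronglyMeasurable _ (.of_forall (norm_fourierInv_le g))
  have hu : Lp.toTemperedDistribution hM.toLp = u := by
    ext v
    rw [Lp.toTemperedDistribution_apply, h.apply_eq_integral hg]
    refine integral_congr_ae ?_
    filter_upwards [hM.coeFn_toLp] with x hx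
    rw [hx, smul_eq_mul]
  refine (distLpNorm_le hu).trans ?_
  rw [Lp.enorm_toLp, eLpNorm_exponent_top, ← ofReal_integral_norm_eq_lintegral_enorm hg]
  refine eLpNormEssSup_le_of_ae_enorm_bound (.of_forall fun x => ?_)
  rw [← ofReal_norm]
  exact ENNReal.ofReal_le_ofReal (norm_fourierInv_le g x)

/-- The L^∞ norm of θ(lD)u is at most the L¹ norm of its density θ(l ·) f, which concentrates on a
null set. -/
theorem HasFourierDensity.isHomogeneous [NeZero d] {u : 𝓢'(Sp d, ℂ)} {f : Sp d → ℂ}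
    (h : HasFourierDensity u f) : IsHomogeneous u := by
  intro θ h1 h2
  refine tendsto_of_tendsto_of_tendsto_of_le_of_le' tendsto_const_nhds
    (tendsto_lintegral_dilate_cutoff_atTop h1.continuous h2 h.measurable h.integrableOn_closedBall)
    (.of_forall fun _ => zero_le) ?_
  filter_upwards [eventually_gt_atTop 0] with l hl
  exact (h.multiplier (cutoff_scale h1 h2 l)).distLpNorm_top_le (h.integrable_cutoff_mul h1 h2 hl)

theorem HasFourierDensity.distLpNorm_two_sq_le {u : 𝓢'(Sp d, ℂ)} {g : Sp d → ℂ}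
    (h : HasFourierDensity u g) : distLpNorm 2 u ^ 2 ≤ ∫⁻ ξ, ‖g ξ‖ₑ ^ 2 := by
  by_cases htop : ∫⁻ ξ, ‖g ξ‖ₑ ^ 2 = ⊤
  · simp [htop]
  have hpow := eLpNorm_nnreal_pow_eq_lintegral (μ := (volume : Measure (Sp d))) (f := g) (p := 2)
    (by norm_num)
  simp only [NNReal.coe_ofNat, ENNReal.coe_ofNat, ENNReal.rpow_ofNat] at hpow
  have hM : MemLp g 2 := by
    refine ⟨h.measurable.aestronglyMeasurable, ?_⟩
    rw [← hpow] at htop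
    exact (ENNReal.pow_lt_top_iff.1 (lt_top_iff_ne_top.2 htop)).resolve_right (by norm_num)
  have hF : 𝓕 u = Lp.toTemperedDistribution hM.toLp := by
    ext v
    rw [Lp.toTemperedDistribution_apply, h.fourier_apply]
    refine integral_congr_ae ?_
    filter_upwards [hM.coeFn_toLp] with x hx
    rw [hx, smul_eq_mul]
  have hu : Lp.toTemperedDistribution (𝓕⁻ hM.toLp) = u := by
    rw [← Lp.fourierInv_toTemperedDistribution_eq, ← hF, FourierTransform.fourierInv_fourier_eq]
  have hn : ‖𝓕⁻ hM.toLp‖ₑ = eLpNorm g 2 := by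
    rw [← Lp.enorm_toLp hM, ← ofReal_norm, ← Lp.norm_fourier_eq,
      FourierTransform.fourier_fourierInv_eq, ofReal_norm]
  rw [← hpow, ← hn]
  exact pow_le_pow_left₀ zero_le (distLpNorm_le hu) 2

/-- Plancherel on each block. The symbols lie in [0, 1], so their squares are bounded by themselves,
and they sum to 1 off the origin. No restriction on r is needed in this direction. -/
theorem DyadicPartition.sobolevNorm_sq_le [NeZero d] (P : DyadicPartition d) {u : 𝓢'(Sp d, ℂ)}
    {f : Sp d → ℂ} (h : HasFourierDensity u f) (r : ℝ) : P.sobolevNorm r u ^ 2 ≤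
      ENNReal.ofReal ((4 * Real.pi) ^ |2 * r|) * weightedNormSq r (fun ξ => ‖f ξ‖ₑ) := by
  have hfm := h.measurable
  have hsm : ∀ q, Measurable (P.symbol q) := fun q => by
    have := P.φ_smooth.continuous
    unfold DyadicPartition.symbol
    exact Continuous.measurable (by fun_prop)
  have hterm : ∀ (q : ℤ) (ξ : Sp d), ENNReal.ofReal ((2 : ℝ) ^ (2 * (q : ℝ) * r)) *
      ‖(P.symbol q ξ : ℂ) * f ξ‖ₑ ^ 2 ≤ ENNReal.ofReal (P.symbol q ξ) *
        (ENNReal.ofReal ((4 * Real.pi) ^ |2 * r|) * (weight (2 * r) ξ * ‖f ξ‖ₑ ^ 2)) := by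
    intro q ξ
    by_cases h0 : P.symbol q ξ = 0
    · simp [h0]
    have hring := le_weight_of_mem_ring (P.mem_ring_of_symbol_ne_zero h0) (2 * r)
    rw [show (q : ℝ) * (2 * r) = 2 * (q : ℝ) * r by ring] at hring
    have hsq : ‖(P.symbol q ξ : ℂ)‖ₑ ^ 2 ≤ ENNReal.ofReal (P.symbol q ξ) := by
      rw [← ofReal_norm, Complex.norm_of_nonneg (P.symbol_nonneg q ξ), sq]
      exact mul_le_of_le_one_right zero_le (ENNReal.ofReal_le_one.2 (P.symbol_le_one q ξ))
    calc _ = ENNReal.ofReal ((2 : ℝ) ^ (2 * (q : ℝ) * r)) * ‖(P.symbol q ξ : ℂ)‖ₑ ^ 2 *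
          ‖f ξ‖ₑ ^ 2 := by rw [enorm_mul, mul_pow, ← mul_assoc]
      _ ≤ (ENNReal.ofReal ((4 * Real.pi) ^ |2 * r|) * weight (2 * r) ξ) *
          ENNReal.ofReal (P.symbol q ξ) * ‖f ξ‖ₑ ^ 2 := by gcongr
      _ = _ := by ring
  rw [P.sobolevNorm_sq, weightedNormSq, ← lintegral_const_mul _ (by fun_prop)]
  calc _ ≤ ∑' q : ℤ, ∫⁻ ξ, ENNReal.ofReal ((2 : ℝ) ^ (2 * (q : ℝ) * r)) *
        ‖(P.symbol q ξ : ℂ) * f ξ‖ₑ ^ 2 := by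
        refine ENNReal.tsum_le_tsum fun q => ?_
        rw [lintegral_const_mul' _ _ (by simp)]
        gcongr
        exact (h.multiplier (P.symbol_hasTemperateGrowth q)).distLpNorm_two_sq_le
    _ ≤ ∑' q : ℤ, ∫⁻ ξ, ENNReal.ofReal (P.symbol q ξ) *
        (ENNReal.ofReal ((4 * Real.pi) ^ |2 * r|) * (weight (2 * r) ξ * ‖f ξ‖ₑ ^ 2)) :=
        ENNReal.tsum_le_tsum fun q => lintegral_mono (hterm q)
    _ = ∫⁻ ξ, ∑' q : ℤ, ENNReal.ofReal (P.symbol q ξ) *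
        (ENNReal.ofReal ((4 * Real.pi) ^ |2 * r|) * (weight (2 * r) ξ * ‖f ξ‖ₑ ^ 2)) := by
        rw [lintegral_tsum fun q => by have := hsm q; fun_prop]
    _ = _ := by
        refine lintegral_congr_ae ?_
        filter_upwards [ae_ne_zero] with ξ hξ
        have hs := P.hasSum_symbol hξ
        rw [ENNReal.tsum_mul_right, ← ENNReal.ofReal_tsum_of_nonneg
          (fun q => P.symbol_nonneg q ξ) hs.summable, hs.tsum_eq, ENNReal.ofReal_one, one_mul]

/-! ### The product as a convolution of densities -/

/-- Bounded support makes all moments of g integrable, so every derivative of the transform is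
bounded. -/
theorem hasTemperateGrowth_fourierInv {g : Sp d → ℂ} (hg : Integrable g) {R : ℝ}
    (hR : ∀ ξ, g ξ ≠ 0 → ‖ξ‖ ≤ R) : (𝓕⁻ g).HasTemperateGrowth := by
  have hmom : ∀ n : ℕ, Integrable fun ξ => ‖ξ‖ ^ n * ‖g ξ‖ := by
    intro n
    refine (hg.norm.const_mul (R ^ n)).mono'
      ((Continuous.aestronglyMeasurable (by fun_prop)).mul hg.1.norm) (.of_forall fun ξ => ?_)
    rw [Real.norm_of_nonneg (by positivity)]
    by_cases h0 : g ξ = 0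
    · simp [h0]
    · gcongr
      exact hR ξ h0
  have h1 : (𝓕 g).HasTemperateGrowth := by
    refine ⟨Real.contDiff_fourier (N := ⊤) fun n _ => hmom n, fun n => ⟨0,
      ∫ ξ, ‖VectorFourier.fourierPowSMulRight (innerSL ℝ) g ξ n‖, fun x => ?_⟩⟩
    rw [Real.iteratedFDeriv_fourier (N := ⊤) (fun n _ => hmom n) hg.1 le_top, pow_zero, mul_one]
    exact VectorFourier.norm_fourierIntegral_le_integral_norm _ _ _ _ _
  have e : 𝓕⁻ g = fun x => 𝓕 g (-x) := funext fun x => Real.fourierInv_eq_fourier_neg g x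
  rw [e]
  exact h1.comp (f := fun x => -x) (by fun_prop)

theorem HasFourierDensity.isFunction {u : 𝓢'(Sp d, ℂ)} {g : Sp d → ℂ}
    (h : HasFourierDensity u g) (hg : Integrable g) {R : ℝ} (hR : ∀ ξ, g ξ ≠ 0 → ‖ξ‖ ≤ R) :
    IsFunction u (𝓕⁻ g) := by
  refine ⟨hasTemperateGrowth_fourierInv hg hR, ?_⟩
  ext v
  exact (Function.HasTemperateGrowth.toTemperedDistribution_apply _ _ v).trans
    (h.apply_eq_integral hg v).symm

theorem fourierInv_mul_fourierInv {f g : Sp d → ℂ} (hf : Integrable f) (hg : Integrable g)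
    (x : Sp d) : 𝓕⁻ f x * 𝓕⁻ g x = 𝓕⁻ (fun ζ => ∫ ξ, f ξ * g (ζ - ξ)) x := by
  rw [Real.fourierInv_eq_fourier_neg, Real.fourierInv_eq_fourier_neg, Real.fourierInv_eq_fourier_neg,
    ← Real.fourier_mul_convolution_eq hf hg]
  rfl

theorem integrable_conv {f g : Sp d → ℂ} (hf : Integrable f) (hg : Integrable g) :
    Integrable fun ζ => ∫ ξ, f ξ * g (ζ - ξ) :=
  hf.integrable_convolution (ContinuousLinearMap.mul ℂ ℂ) hg

/-- The convolution of the absolute values of `f` and `g`. -/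
def absConv (f g : Sp d → ℂ) (ζ : Sp d) : ℝ≥0∞ := ∫⁻ ξ, ‖f ξ‖ₑ * ‖g (ζ - ξ)‖ₑ

theorem measurable_absConv {f g : Sp d → ℂ} (hf : Measurable f) (hg : Measurable g) :
    Measurable (absConv f g) :=
  Measurable.lintegral_prod_right (f := fun ζ ξ : Sp d => ‖f ξ‖ₑ * ‖g (ζ - ξ)‖ₑ) (by fun_prop)

theorem measurable_conv {f g : Sp d → ℂ} (hf : Measurable f) (hg : Measurable g) :
    Measurable fun ζ => ∫ ξ, f ξ * g (ζ - ξ) :=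
  (StronglyMeasurable.integral_prod_right'
    (f := fun x : Sp d × Sp d => f x.2 * g (x.1 - x.2)) (ν := volume)
    (Measurable.stronglyMeasurable (by fun_prop))).measurable

theorem enorm_conv_le (f g : Sp d → ℂ) (ζ : Sp d) :
    ‖∫ ξ, f ξ * g (ζ - ξ)‖ₑ ≤ absConv f g ζ := by
  refine (enorm_integral_le_lintegral_enorm _).trans_eq ?_
  simp only [enorm_mul, absConv]

theorem weightedNormSq_mono {r : ℝ} {F G : Sp d → ℝ≥0∞} (h : ∀ ξ, F ξ ≤ G ξ) :
    weightedNormSq r F ≤ weightedNormSq r G :=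
  lintegral_mono fun ξ => by dsimp only; gcongr; exact h ξ

theorem ae_lt_top_of_weightedNormSq [NeZero d] {r : ℝ} {F : Sp d → ℝ≥0∞} (hF : Measurable F)
    (h : weightedNormSq r F ≠ ⊤) : ∀ᵐ ξ, F ξ < ⊤ := by
  filter_upwards [ae_ne_zero, ae_lt_top (by fun_prop) h] with ξ hξ hlt
  by_contra htop
  rw [not_lt, top_le_iff] at htop
  rw [htop, ENNReal.top_pow (by norm_num), ENNReal.mul_top] at hlt
  · exact lt_irrefl _ hlt
  · have := norm_pos_iff.2 hξ
    exact (ENNReal.ofReal_pos.2 (by positivity)).ne'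

theorem tendsto_conv_cutoff {θ : Sp d → ℂ} (h1 : Continuous θ) {K : ℝ} (hK : ∀ ξ, ‖θ ξ‖ ≤ K)
    (h3 : ∀ᶠ ξ in 𝓝 0, θ ξ = 1) {f g : Sp d → ℂ} (hf : Measurable f) (hg : Measurable g)
    {ζ : Sp d} (hζ : absConv f g ζ < ⊤) :
    Tendsto (fun ε : ℝ => ∫ ξ, θ (ε • ξ) * f ξ * (θ (ε • (ζ - ξ)) * g (ζ - ξ))) (𝓝[>] 0)
      (𝓝 (∫ ξ, f ξ * g (ζ - ξ))) := by
  have hK0 : 0 ≤ K := (norm_nonneg _).trans (hK 0)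
  have hθm := h1.measurable
  have hint : Integrable fun ξ => f ξ * g (ζ - ξ) := by
    refine ⟨Measurable.aestronglyMeasurable (by fun_prop), ?_⟩
    simpa only [HasFiniteIntegral, enorm_mul, absConv] using hζ
  refine tendsto_integral_filter_of_dominated_convergence
    (fun ξ => K * K * ‖f ξ * g (ζ - ξ)‖) ?_ ?_ (hint.norm.const_mul _) ?_
  · exact .of_forall fun ε => Measurable.aestronglyMeasurable (by fun_prop)
  · refine .of_forall fun ε => .of_forall fun ξ => ?_
    calc _ = ‖θ (ε • ξ)‖ * ‖θ (ε • (ζ - ξ))‖ * ‖f ξ * g (ζ - ξ)‖ := by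
          simp only [norm_mul]; ring
      _ ≤ _ := by gcongr <;> exact hK _
  · refine .of_forall fun ξ => tendsto_const_nhds.congr' ?_
    filter_upwards [tendsto_dilate_cutoff_nhds h3 ξ, tendsto_dilate_cutoff_nhds h3 (ζ - ξ)]
      with ε e1 e2
    rw [e1, e2, one_mul, one_mul]

theorem enorm_conv_cutoff_le {θ : Sp d → ℂ} {K : ℝ} (hK : ∀ ξ, ‖θ ξ‖ ≤ K) (f g : Sp d → ℂ)
    (ε : ℝ) (ζ : Sp d) :
    ‖∫ ξ, θ (ε • ξ) * f ξ * (θ (ε • (ζ - ξ)) * g (ζ - ξ))‖ₑ ≤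
      ENNReal.ofReal (K * K) * absConv f g ζ := by
  have hK0 : 0 ≤ K := (norm_nonneg _).trans (hK 0)
  have hK' : ∀ ξ, ‖θ ξ‖ₑ ≤ ENNReal.ofReal K := fun ξ => by
    rw [← ofReal_norm]; exact ENNReal.ofReal_le_ofReal (hK ξ)
  refine (enorm_integral_le_lintegral_enorm _).trans ?_
  rw [absConv, ← lintegral_const_mul' _ _ (by simp), ENNReal.ofReal_mul hK0]
  refine lintegral_mono fun ξ => ?_
  calc _ = ‖θ (ε • ξ)‖ₑ * ‖θ (ε • (ζ - ξ))‖ₑ * (‖f ξ‖ₑ * ‖g (ζ - ξ)‖ₑ) := by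
        simp only [enorm_mul]; ring
    _ ≤ _ := by gcongr <;> exact hK' _

/-- If the convolution of the Fourier transforms of `a` and `b` converges absolutely to a function
which is the Fourier transform of `c`, then `c` is the product of `a` and `b`. -/
theorem isProduct_of_density [NeZero d] {a b c : 𝓢'(Sp d, ℂ)} {f g : Sp d → ℂ}
    (ha : HasFourierDensity a f) (hb : HasFourierDensity b g)
    (hc : HasFourierDensity c fun ζ => ∫ ξ, f ξ * g (ζ - ξ)) {r : ℝ} (hr : |r| < (d : ℝ) / 2)
    (hW : weightedNormSq r (absConv f g) ≠ ⊤) : IsProduct a b c := by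
  intro θ h1 h2 h3
  obtain ⟨K, hK⟩ := h2.exists_bound_of_continuous h1.continuous
  obtain ⟨R, -, hR⟩ := h2.isCompact.isBounded.exists_pos_norm_le
  have hfm := ha.measurable
  have hgm := hb.measurable
  have hθm := h1.continuous.measurable
  have hCm := measurable_absConv hfm hgm
  have hsupp : ∀ {ε : ℝ}, 0 < ε → ∀ (k : Sp d → ℂ) ξ, θ (ε • ξ) * k ξ ≠ 0 → ‖ξ‖ ≤ R / ε := by
    intro ε hε k ξ hξ
    have := hR _ (subset_tsupport _ (left_ne_zero_of_mul hξ))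
    rw [norm_smul, Real.norm_of_nonneg hε.le] at this
    rwa [le_div_iff₀' hε]
  -- The regularized product, with the convolution theorem transferring its pairing to the Fourier
  -- side; the value for ε ≤ 0 is arbitrary.
  have hex : ∀ ε : ℝ, ∃ p : 𝓢'(Sp d, ℂ), 0 < ε →
      IsFunction p (fun x => 𝓕⁻ (fun ξ => θ (ε • ξ) * f ξ) x * 𝓕⁻ (fun ξ => θ (ε • ξ) * g ξ) x) ∧
      ∀ v : 𝓢(Sp d, ℂ), p v = ∫ ζ, (𝓕⁻ v) ζ *
        ∫ ξ, θ (ε • ξ) * f ξ * (θ (ε • (ζ - ξ)) * g (ζ - ξ)) := by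
    intro ε
    by_cases hε : 0 < ε
    · have if_ := ha.integrable_cutoff_mul h1 h2 hε
      have ig := hb.integrable_cutoff_mul h1 h2 hε
      have tf := hasTemperateGrowth_fourierInv if_ (hsupp hε f)
      have tg := hasTemperateGrowth_fourierInv ig (hsupp hε g)
      refine ⟨(tf.mul tg).toTemperedDistribution, fun _ => ⟨⟨tf.mul tg, rfl⟩, fun v => ?_⟩⟩
      have e := integral_fourierInv_mul_eq v.integrable (integrable_conv if_ ig)
      rw [← SchwartzMap.fourierInv_coe] at e
      refine (Function.HasTemperateGrowth.toTemperedDistribution_apply _ _ v).trans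
        (Eq.trans ?_ e.symm)
      refine integral_congr_ae (.of_forall fun x => ?_)
      simp only [smul_eq_mul, Pi.mul_apply]
      rw [fourierInv_mul_fourierInv if_ ig]
    · exact ⟨0, fun h => absurd h hε⟩
  choose p hp using hex
  refine ⟨fun ε => 𝓕⁻ fun ξ => θ (ε • ξ) * f ξ, fun ε => 𝓕⁻ fun ξ => θ (ε • ξ) * g ξ, p,
    fun ε hε => ⟨?_, ?_, (hp ε hε).1⟩, ?_⟩
  · exact (ha.multiplier (cutoff_scale h1 h2 ε)).isFunction (ha.integrable_cutoff_mul h1 h2 hε)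
      (hsupp hε f)
  · exact (hb.multiplier (cutoff_scale h1 h2 ε)).isFunction (hb.integrable_cutoff_mul h1 h2 hε)
      (hsupp hε g)
  rw [PointwiseConvergenceCLM.tendsto_iff_forall_tendsto]
  intro v
  have hfin := ae_lt_top_of_weightedNormSq hCm hW
  have hpv : ∀ ε, 0 < ε → p ε v = _ := fun ε hε => (hp ε hε).2 v
  rw [hc.apply]
  generalize 𝓕⁻ v = w at hpv ⊢
  -- The dominating function, up to the factor K²: the finite weighted norm of `absConv` and |r| <
  -- d/2 make it integrable against w.
  have hbd : Integrable fun ζ => w ζ * ((absConv f g ζ).toReal : ℂ) := by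
    refine integrable_schwartz_mul (integrable_decay_mul hr (by fun_prop) ?_) _
    refine ((weightedNormSq_mono fun ζ => ?_).trans_lt hW.lt_top).ne
    rw [← ofReal_norm, Complex.norm_of_nonneg ENNReal.toReal_nonneg]
    exact ENNReal.ofReal_toReal_le
  have hlim : Tendsto (fun ε : ℝ => ∫ ζ, w ζ *
      ∫ ξ, θ (ε • ξ) * f ξ * (θ (ε • (ζ - ξ)) * g (ζ - ξ))) (𝓝[>] 0)
      (𝓝 (∫ ζ, w ζ * ∫ ξ, f ξ * g (ζ - ξ))) := by
    refine tendsto_integral_filter_of_dominated_convergence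
      (fun ζ => K * K * ‖w ζ * ((absConv f g ζ).toReal : ℂ)‖) ?_ ?_ (hbd.norm.const_mul _) ?_
    · refine .of_forall fun ε => w.continuous.aestronglyMeasurable.mul ?_
      exact (measurable_conv (f := fun ξ => θ (ε • ξ) * f ξ) (g := fun ξ => θ (ε • ξ) * g ξ)
        (by fun_prop) (by fun_prop)).aestronglyMeasurable
    · refine .of_forall fun ε => ?_
      filter_upwards [hfin] with ζ hζ
      have hb := enorm_conv_cutoff_le hK f g ε ζ
      rw [← ENNReal.ofReal_toReal hζ.ne, ← ENNReal.ofReal_mul (mul_self_nonneg K), ← ofReal_norm,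
        ENNReal.ofReal_le_ofReal_iff (mul_nonneg (mul_self_nonneg K) ENNReal.toReal_nonneg)] at hb
      rw [norm_mul, norm_mul, Complex.norm_of_nonneg ENNReal.toReal_nonneg]
      calc _ ≤ ‖w ζ‖ * (K * K * (absConv f g ζ).toReal) := by gcongr
        _ = _ := by ring
    · filter_upwards [hfin] with ζ hζ
      exact (tendsto_conv_cutoff h1.continuous hK h3 hfm hgm hζ).const_mul _
  refine hlim.congr' ?_
  filter_upwards [self_mem_nhdsWithin] with ε hε
  exact (hpv ε hε).symm

end HomSobolev

end

/-! ### The product theorem -/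

theorem theoremA1 (d : ℕ) (P : HomSobolev.DyadicPartition d) (s t : ℝ)
    (hs : |s| < (d : ℝ) / 2) (ht : |t| < (d : ℝ) / 2) (hst : 0 < s + t) :
    ∃ C : ℝ, 0 < C ∧ ∀ a b : 𝓢'(HomSobolev.Sp d, ℂ),
      P.MemSobolev s a → P.MemSobolev t b →
        ∃ c : 𝓢'(HomSobolev.Sp d, ℂ), HomSobolev.IsProduct a b c ∧
          P.MemSobolev (s + t - (d : ℝ) / 2) c ∧
          P.sobolevNorm (s + t - (d : ℝ) / 2) c ≤
            ENNReal.ofReal C * P.sobolevNorm s a * P.sobolevNorm t b := by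
  open HomSobolev in
  have hd : NeZero d := ⟨by
    rintro rfl
    have := (abs_nonneg s).trans_lt hs
    simp at this⟩
  set r := s + t - (d : ℝ) / 2 with hr_def
  -- The lower bound is s + t > 0 and the upper bound is s + t < d, so the target exponent is again
  -- in the range where finite weighted norm gives a tempered density.
  have hr : |r| < (d : ℝ) / 2 := by
    rw [abs_lt] at hs ht ⊢
    constructor <;> linarith [hs.2, ht.2]
  obtain ⟨C₀, hC₀, hconv⟩ := exists_weightedNormSq_conv_le s t hs ht hst
  set k : ℝ → ℝ≥0∞ := fun p => ENNReal.ofReal ((4 * Real.pi) ^ |2 * p|) with hk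
  set D : ℝ≥0∞ := k r * (C₀ * ((3 * k s) * (3 * k t))) with hD
  have hDtop : D ≠ ⊤ := by simp only [hD, hk]; finiteness
  -- The estimates concern squared norms with constant D; since D ≤ (D + 1)², D + 1 serves after
  -- taking roots and is positive even if D = 0.
  refine ⟨D.toReal + 1, by positivity, fun a b ha hb => ?_⟩
  obtain ⟨f, hf, hfW⟩ := ha.exists_density hs
  obtain ⟨g, hg, hgW⟩ := hb.exists_density ht
  have hle : weightedNormSq r (absConv f g) ≤
      C₀ * ((3 * k s * P.sobolevNorm s a ^ 2) * (3 * k t * P.sobolevNorm t b ^ 2)) := by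
    refine (hconv _ _ hf.measurable.enorm hg.measurable.enorm).trans ?_
    gcongr
  have hW : weightedNormSq r (absConv f g) ≠ ⊤ := by
    refine (hle.trans_lt ?_).ne
    have h1 := ha.2
    have h2 := hb.2
    simp only [hk]
    finiteness
  have hWh : weightedNormSq r (fun ζ => ‖∫ ξ, f ξ * g (ζ - ξ)‖ₑ) ≤
      weightedNormSq r (absConv f g) := weightedNormSq_mono (enorm_conv_le f g)
  have hm := measurable_conv hf.measurable hg.measurable
  obtain ⟨c, hc⟩ := exists_hasFourierDensity hm
    (integrable_decay_mul hr hm (hWh.trans_lt hW.lt_top).ne)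
  have hsq : P.sobolevNorm r c ^ 2 ≤
      (ENNReal.ofReal (D.toReal + 1) * P.sobolevNorm s a * P.sobolevNorm t b) ^ 2 := by
    have hD1 : D ≤ ENNReal.ofReal (D.toReal + 1) ^ 2 := by
      have h0 : 0 ≤ D.toReal := ENNReal.toReal_nonneg
      rw [← ENNReal.ofReal_pow (by positivity)]
      conv_lhs => rw [← ENNReal.ofReal_toReal hDtop]
      exact ENNReal.ofReal_le_ofReal (by nlinarith)
    calc P.sobolevNorm r c ^ 2 ≤ k r * weightedNormSq r (absConv f g) :=
          (P.sobolevNorm_sq_le hc r).trans (by gcongr)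
      _ ≤ k r * (C₀ * ((3 * k s * P.sobolevNorm s a ^ 2) * (3 * k t * P.sobolevNorm t b ^ 2))) := by
          gcongr
      _ = D * (P.sobolevNorm s a ^ 2 * P.sobolevNorm t b ^ 2) := by rw [hD]; ring
      _ ≤ ENNReal.ofReal (D.toReal + 1) ^ 2 *
          (P.sobolevNorm s a ^ 2 * P.sobolevNorm t b ^ 2) := by gcongr
      _ = _ := by ring
  have hnorm : P.sobolevNorm r c ≤
      ENNReal.ofReal (D.toReal + 1) * P.sobolevNorm s a * P.sobolevNorm t b :=
    (ENNReal.pow_le_pow_left_iff two_ne_zero).1 hsq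
  refine ⟨c, isProduct_of_density hf hg hc hr hW, ⟨hc.isHomogeneous, hnorm.trans_lt ?_⟩, hnorm⟩
  have h1 := ha.2
  have h2 := hb.2
  finiteness
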